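/- **Theorem.** Let $k$ be a field and let $n\ge 1$. Let $\mathrm{GA}_n(k)$ be the group, under composition, of polynomial automorphisms of affine $n$-space over $k$, i.e. of the tuples $F=(F_1,\dots,F_n)$ with $F_i\in k[X_1,\dots,X_n]$ that have an inverse tuple of the same kind, where $(F\circ G)_i=F_i(G_1,\dots,G_n)$. Let $\mathrm{GL}_n(k)\subseteq \mathrm{GA}_n(k)$ be the subgroup of the linear automorphisms $X\mapsto AX$ with $A$ an invertible $n\times n$ matrix over $k$, and let $\mathrm{TA}_n(k)\subseteq\mathrm{GA}_n(k)$ be the tame subgroup, generated by the affine automorphisms $X\mapsto AX+b$ ($A$ an invertible matrix over $k$, $b\in k^n$) and the elementary automorphisms $$E_{i,\alpha}=(X_1,\dots,X_{i-1},X_i+X^\alpha,X_{i+1},\dots,X_n),$$ where $1\le i\le n$ and $X^\alpha$ is a monomial in the variables $X_j$, $j\ne i$. Let $\mathrm{GLIN}_n(k)$ and $\mathrm{GTAM}_n(k)$ be the normal closures in $\mathrm{GA}_n(k)$ of $\mathrm{GL}_n(k)$ and of $\mathrm{TA}_n(k)$, respectively, and let $\mathrm{TLIN}_n(k)$ be the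 normal closure of $\mathrm{GL}_n(k)$ in $\mathrm{TA}_n(k)$. 1. If $k\not\cong\mathbb F_2$, then $\mathrm{GLIN}_n(k)=\mathrm{GTAM}_n(k)$ and $\mathrm{TLIN}_n(k)=\mathrm{TA}_n(k)$. 2. If $k=\mathbb F_2$, then $\mathrm{GLIN}_n(\mathbb F_2)\subsetneq\mathrm{GTAM}_n(\mathbb F_2)$ and $\mathrm{TLIN}_n(\mathbb F_2)\subsetneq\mathrm{TA}_n(\mathbb F_2)$. -/

import Mathlib

namespace PolyAut

open MvPolynomial

/-- A polynomial map `(F₁, …, Fₙ)` of affine `n`-space over `k`, given by its coordinate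
polynomials `Fᵢ ∈ k[X₁, …, Xₙ]`. -/
@[ext]
structure PolyMap (k : Type*) [CommRing k] (n : ℕ) where
  coord : Fin n → MvPolynomial (Fin n) k

/-- Polynomial maps form a monoid under composition:
`(F * G)ᵢ = Fᵢ(G₁, …, Gₙ)`, with neutral element `(X₁, …, Xₙ)`. -/
noncomputable instance {k : Type*} [CommRing k] {n : ℕ} : Monoid (PolyMap k n) where
  mul F G := ⟨fun i => bind₁ G.coord (F.coord i)⟩
  one := ⟨fun i => X i⟩
  mul_assoc F G H := by
    ext1
    funext i
    exact bind₁_bind₁ _ _ _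
  one_mul F := by
    ext1
    funext i
    exact bind₁_X_right _ _
  mul_one F := by
    ext1
    funext i
    change bind₁ X (F.coord i) = F.coord i
    simp

theorem PolyMap.mul_coord {k : Type*} [CommRing k] {n : ℕ} (F G : PolyMap k n) (i : Fin n) :
    (F * G).coord i = bind₁ G.coord (F.coord i) := rfl

theorem PolyMap.one_coord {k : Type*} [CommRing k] {n : ℕ} (i : Fin n) :
    (1 : PolyMap k n).coord i = X i := rfl

/-- The group `GAₙ(k)` of polynomial automorphisms: the polynomial maps having a two-sided
inverse polynomial map, under composition. -/
abbrev GA (k : Type*) [CommRing k] (n : ℕ) : Type _ := (PolyMap k n)ˣ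

/-- A square matrix `A` as the polynomial map `X ↦ A X`. -/
noncomputable def linearMap (k : Type*) [CommRing k] (n : ℕ) :
    Matrix (Fin n) (Fin n) k →* PolyMap k n where
  toFun A := ⟨fun i => ∑ j, C (A i j) * X j⟩
  map_one' := by
    ext1
    funext i
    change ∑ j, C ((1 : Matrix (Fin n) (Fin n) k) i j) * X j = X i
    rw [Finset.sum_eq_single i]
    · simp
    · intro j _ hj
      simp [Matrix.one_apply_ne hj.symm]
    · simp
  map_mul' A B := by
    ext1
    funext i
    simp only [PolyMap.mul_coord, map_sum, map_mul, bind₁_C_right, bind₁_X_right,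
      Matrix.mul_apply, Finset.sum_mul, Finset.mul_sum]
    rw [Finset.sum_comm]
    simp only [mul_assoc]

/-- `GLₙ(k)` as the subgroup of `GAₙ(k)` of the linear automorphisms `X ↦ A X`, where `A` is an
invertible matrix. -/
noncomputable def linearSubgroup (k : Type*) [CommRing k] (n : ℕ) : Subgroup (GA k n) :=
  (Units.map (linearMap k n)).range

/-- Affine automorphisms `X ↦ A X + b`, with `A` an invertible matrix and `b ∈ kⁿ`. -/
def IsAffine {k : Type*} [CommRing k] {n : ℕ} (F : GA k n) : Prop :=
  ∃ (A : Matrix.GeneralLinearGroup (Fin n) k) (b : Fin n → k),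
    ∀ i, F.val.coord i = ∑ j, C (A.val i j) * X j + C (b i)

/-- The elementary automorphisms `E_{i,α} = (X₁, …, Xᵢ + X^α, …, Xₙ)`, where the monomial `X^α`
does not involve `Xᵢ`. -/
def IsElementary {k : Type*} [CommRing k] {n : ℕ} (F : GA k n) : Prop :=
  ∃ (i : Fin n) (α : Fin n →₀ ℕ), α i = 0 ∧
    F.val.coord i = X i + monomial α 1 ∧ ∀ j, j ≠ i → F.val.coord j = X j

/-- The tame group `TAₙ(k)`, generated by the affine and the elementary automorphisms. -/
noncomputable def TA (k : Type*) [CommRing k] (n : ℕ) : Subgroup (GA k n) :=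
  Subgroup.closure {F | IsAffine F ∨ IsElementary F}

theorem linearSubgroup_le_TA (k : Type*) [CommRing k] (n : ℕ) : linearSubgroup k n ≤ TA k n := by
  rintro _ ⟨A, rfl⟩
  refine Subgroup.subset_closure (Or.inl ⟨A, 0, fun i => ?_⟩)
  simp [linearMap]

/-- `GLINₙ(k)`: the normal closure of `GLₙ(k)` in `GAₙ(k)`. -/
noncomputable def GLIN (k : Type*) [CommRing k] (n : ℕ) : Subgroup (GA k n) :=
  Subgroup.normalClosure (linearSubgroup k n : Set (GA k n))

/-- `GTAMₙ(k)`: the normal closure of `TAₙ(k)` in `GAₙ(k)`. -/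
noncomputable def GTAM (k : Type*) [CommRing k] (n : ℕ) : Subgroup (GA k n) :=
  Subgroup.normalClosure (TA k n : Set (GA k n))

/-- `TLINₙ(k)`: the normal closure of `GLₙ(k)` in its overgroup `TAₙ(k)`, regarded as a subgroup
of `GAₙ(k)`. -/
noncomputable def TLIN (k : Type*) [CommRing k] (n : ℕ) : Subgroup (GA k n) :=
  (Subgroup.normalClosure ((linearSubgroup k n).subgroupOf (TA k n) : Set (TA k n))).map
    (TA k n).subtype

end PolyAut

/-!
If `k` has a scalar `c ≠ 0, 1`, there are nonzero scalars `w₁` and `w₂ = w₁ + 1`. Dilations `d(w)`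
conjugate an elementary automorphism or a translation `F = X + p` into `X + w p`, and these compose
by adding the parts `w p`, so that `F` is the quotient of its conjugates by `d(w₂)` and `d(w₁)` and
hence lies in the normal closure of the linear maps in the tame group (`mem_TLIN_of_scaling`).

Over `𝔽₂` both normal closures are separated by a homomorphism from `GAₙ(𝔽₂)` to a group of order
two that kills the linear maps but not every tame map (`lt_of_hom`).

For `n ≠ 2` this is the sign of the permutation of the points of `𝔽₂ⁿ`. The transvections generate
`GLₙ(𝔽₂)` and are commutators for `n ≥ 3` (there are none for `n = 1`), so linear maps are even,
whereas `X_i ↦ X_i + ∏_{j ≠ i} X_j` exchanges just two points (`pointSign_linear`,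
`pointSign_elementary`).

For `n = 2` the transvections of `GL₂(𝔽₂)` are odd, and the homomorphism comes from the structure
of the automorphism group of the plane. An automorphism is a pair `x, y` of generators of
`k[s, t]`, and the sum of the values of the functional `f ↦ f'(0) + f'(1)` at the quotients of the
Euclidean algorithm for `x` and `y`, with respect to the degree in `t` and with quotients in
`k[y]`, is additive under composition with shears (`pairWeight_shear`) and invariant under the
exchange of the coordinates (`pairWeight_swap`). By the theorem of Jung and van der Kulk these
generate the group (`mem_of_swap_of_shear`), so that the sum is a homomorphism. It vanishes on
linear maps, but not on `(X₀ + X₁³, X₁)`.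

Every member of a pair of generators over `𝔽₂` is monic in `t` or of the form `s + c`
(`Generates.cases`). So the Euclidean algorithm works if one of the degrees `g a` and `g b` of `x`
and `y` in `t`, with coprime `a` and `b`, divides the other one (`natDegree_dvd_of_generators`). To
see this, consider on `k(s, t)` the valuation given by minus the degree in `t`, as a valuation of
the field of rational functions in `x` and `y`. It is centred at the point `x ^ b = y ^ a` at
infinity of the weighted projective plane with weights `a` and `b`. In the local coordinates
`x ^ μ / y ^ ν` and `x ^ b / y ^ a - 1`, where `ν b = a μ + 1`, the Jacobian determinant has order
`g (1 + a + b)`, because that of `x` and `y` is a unit. The polynomial `P` with `P(x, y) = s` has a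
pole of some weighted order `N > 0` along the line at infinity, and multiplicity at most
`N / (a b)` at that point. Since `s` has value zero, its numerator vanishes to order `N g`, while
resolving the centre by blowing up points bounds this order by the multiplicity times
`g (1 + a + b) - 1` (`blowup_bound`). Hence `a b g < g (1 + a + b)`, which is impossible if
`a, b ≥ 2` are coprime.
-/

namespace PolyAut

open MvPolynomial

/-! ### Fields with a scalar different from `0` and `1` -/

theorem exists_unit_ne_one {k : Type*} [Field k] (h : IsEmpty (k ≃+* ZMod 2)) :
    ∃ c : k, c ≠ 0 ∧ c ≠ 1 := by
  by_contra! hc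
  have hall : ∀ c : k, c = 0 ∨ c = 1 := fun c => by
    by_cases h0 : c = 0
    · exact Or.inl h0
    · exact Or.inr (hc c h0)
  have h2 : (2 : k) = 0 := by
    rcases hall 2 with h2 | h2
    · exact h2
    · exact absurd (show (1 : k) = 0 by linear_combination h2) one_ne_zero
  have : CharP k 2 := CharTwo.of_one_ne_zero_of_two_eq_zero one_ne_zero h2
  refine h.elim (RingEquiv.ofBijective (ZMod.castHom (dvd_refl 2) k)
    ⟨RingHom.injective _, fun c => ?_⟩).symm
  rcases hall c with rfl | rfl
  · exact ⟨0, map_zero _⟩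
  · exact ⟨1, map_one _⟩

theorem bind₁_monomial_of_eq_X {k : Type*} [CommRing k] {n : ℕ} {α : Fin n →₀ ℕ} {i : Fin n}
    (hα : α i = 0) (c : k) {f : Fin n → MvPolynomial (Fin n) k} (hf : ∀ j, j ≠ i → f j = X j) :
    bind₁ f (monomial α c) = monomial α c := by
  rw [bind₁_monomial, monomial_eq, Finsupp.prod]
  congr 1
  refine Finset.prod_congr rfl fun j hj => ?_
  rw [hf j]
  rintro rfl
  exact (Finsupp.mem_support_iff.mp hj) hα

section Scaling

variable {k : Type*} [Field k] {n : ℕ}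

theorem ext_coord {F G : GA k n} (h : ∀ j, F.val.coord j = G.val.coord j) : F = G :=
  Units.ext (PolyMap.ext (funext h))

theorem mul_val_coord (F G : GA k n) (j : Fin n) :
    (F * G).val.coord j = bind₁ G.val.coord (F.val.coord j) := rfl

/-- The diagonal linear automorphism `X_j ↦ w_j X_j`. -/
noncomputable def dilation (k : Type*) [Field k] (n : ℕ) : (Fin n → kˣ) →* GA k n :=
  (Units.map (linearMap k n)).comp <|
    (Units.map (Matrix.diagonalRingHom (Fin n) k : (Fin n → k) →* Matrix (Fin n) (Fin n) k)).comp
      MulEquiv.piUnits.symm.toMonoidHom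

theorem dilation_mem (w : Fin n → kˣ) : dilation k n w ∈ linearSubgroup k n :=
  ⟨_, rfl⟩

theorem dilation_coord (w : Fin n → kˣ) (j : Fin n) :
    (dilation k n w).val.coord j = C (w j : k) * X j := by
  change ∑ l, C (Matrix.diagonal (fun i => (w i : k)) j l) * X l = _
  rw [Finset.sum_eq_single j]
  · simp
  · intro l _ hl
    simp [Matrix.diagonal_apply_ne' _ hl]
  · simp

theorem linearSubgroup_le_TLIN : linearSubgroup k n ≤ TLIN k n := fun A hA =>
  ⟨⟨A, linearSubgroup_le_TA k n hA⟩, Subgroup.subset_normalClosure hA, rfl⟩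

theorem TLIN_le_TA : TLIN k n ≤ TA k n := by
  rintro _ ⟨A, _, rfl⟩
  exact A.2

theorem conj_mem_TLIN {A F : GA k n} (hA : A ∈ TLIN k n) (hF : F ∈ TA k n) :
    F * A * F⁻¹ ∈ TLIN k n := by
  obtain ⟨A, hA, rfl⟩ := hA
  refine Subgroup.mem_map.mpr ⟨⟨F, hF⟩ * A * ⟨F, hF⟩⁻¹, ?_, ?_⟩
  · exact Subgroup.normalClosure_normal.conj_mem A hA _
  · simp only [map_mul, map_inv, Subgroup.subtype_apply]

/-- If conjugation by the linear maps `d w` multiplies the nonlinear part `p` of `F` by `w`, and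
composition with `F` adds nonlinear parts, then `F` lies in the normal closure of the linear maps:
with `w₂ = w₁ + 1`, which has a solution in units when `k` has a scalar `c ≠ 0, 1`, the element `F`
is the quotient of its conjugates by `d w₂` and `d w₁`. -/
theorem mem_TLIN_of_scaling {c : k} (hc0 : c ≠ 0) (hc1 : c ≠ 1) {F : GA k n} (hF : F ∈ TA k n)
    (p : Fin n → MvPolynomial (Fin n) k) (d : kˣ → GA k n)
    (hd : ∀ w, d w ∈ linearSubgroup k n)
    (hconj : ∀ w j, (d w * F).val.coord j = bind₁ (d w).val.coord (X j + C (w : k) * p j))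
    (hFp : ∀ j, F.val.coord j = X j + p j)
    (hp : ∀ (v : k) j, bind₁ (fun i => X i + C v * p i) (p j) = p j) : F ∈ TLIN k n := by
  have hc : c - 1 ≠ 0 := sub_ne_zero.mpr hc1
  let w₁ : kˣ := (Units.mk0 (c - 1) hc)⁻¹
  let w₂ : kˣ := Units.mk0 c hc0 * w₁
  have hw : (w₂ : k) = 1 + w₁ := by
    simp only [w₂, w₁, Units.val_mul, Units.val_mk0, Units.val_inv_eq_inv_val]
    field_simp
    ring
  have hcoord : ∀ w j, (d w * F * (d w)⁻¹).val.coord j = X j + C (w : k) * p j := by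
    intro w j
    rw [mul_val_coord, hconj, bind₁_bind₁]
    have : (fun i => bind₁ ((d w)⁻¹).val.coord ((d w).val.coord i)) = X := by
      funext i
      rw [← mul_val_coord, mul_inv_cancel]
      rfl
    rw [this, bind₁_X_left]
    rfl
  have key : d w₂ * F * (d w₂)⁻¹ = F * (d w₁ * F * (d w₁)⁻¹) := by
    refine ext_coord fun j => ?_
    rw [hcoord, mul_val_coord, hFp, map_add, bind₁_X_right]
    have : (d w₁ * F * (d w₁)⁻¹).val.coord = fun i => X i + C (w₁ : k) * p i :=
      funext (hcoord w₁)
    rw [this, hp, hw, map_add, map_one]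
    ring
  have hFeq : F = d w₂ * (F * ((d w₂)⁻¹ * d w₁) * F⁻¹) * (d w₁)⁻¹ := by
    refine (mul_inv_eq_of_eq_mul key).symm.trans ?_
    group
  have hlin := fun w => linearSubgroup_le_TLIN (hd w)
  rw [hFeq]
  exact mul_mem (mul_mem (hlin _) (conj_mem_TLIN (mul_mem (inv_mem (hlin _)) (hlin _)) hF))
    (inv_mem (hlin _))

theorem IsElementary.mem_TLIN {c : k} (hc0 : c ≠ 0) (hc1 : c ≠ 1) {F : GA k n}
    (hF : IsElementary F) : F ∈ TLIN k n := by
  have hFT : F ∈ TA k n := Subgroup.subset_closure (Or.inr hF)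
  obtain ⟨i, α, hα, hi, hj⟩ := hF
  refine mem_TLIN_of_scaling hc0 hc1 hFT (fun j => if j = i then monomial α 1 else 0)
    (fun w => dilation k n (Pi.mulSingle i w)) (fun w => dilation_mem _) (fun w j => ?_)
    (fun j => ?_) (fun v j => ?_)
  · rw [mul_val_coord, dilation_coord]
    rcases eq_or_ne j i with rfl | h
    · rw [map_mul, bind₁_X_right, bind₁_C_right, hi, if_pos rfl, map_add, map_mul, bind₁_C_right,
        bind₁_X_right, dilation_coord, bind₁_monomial_of_eq_X hα 1]
      · rw [Pi.mulSingle_eq_same]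
        ring
      · intro l hl
        rw [dilation_coord, Pi.mulSingle_eq_of_ne hl]
        simp
    · rw [Pi.mulSingle_eq_of_ne h, if_neg h]
      simp [hj j h, dilation_coord, Pi.mulSingle_eq_of_ne h]
  · rcases eq_or_ne j i with rfl | h
    · simp [hi]
    · simp [hj j h, h]
  · rcases eq_or_ne j i with rfl | h
    · rw [if_pos rfl, bind₁_monomial_of_eq_X hα 1]
      intro l hl
      simp [hl]
    · simp [h]

theorem IsAffine.mem_TLIN {c : k} (hc0 : c ≠ 0) (hc1 : c ≠ 1) {F : GA k n}
    (hF : IsAffine F) : F ∈ TLIN k n := by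
  have hFT : F ∈ TA k n := Subgroup.subset_closure (Or.inl hF)
  obtain ⟨A, b, hA⟩ := hF
  let L : GA k n := Units.map (linearMap k n) A
  have hL : L ∈ linearSubgroup k n := ⟨A, rfl⟩
  have hT : ∀ j, (F * L⁻¹).val.coord j = X j + C (b j) := by
    intro j
    have h1 : F.val.coord j = L.val.coord j + C (b j) := hA j
    rw [mul_val_coord, h1, map_add, bind₁_C_right, ← mul_val_coord, mul_inv_cancel]
    rfl
  have hTT : F * L⁻¹ ∈ TA k n := mul_mem hFT (inv_mem (linearSubgroup_le_TA k n hL))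
  have : F * L⁻¹ ∈ TLIN k n := by
    refine mem_TLIN_of_scaling hc0 hc1 hTT (fun j => C (b j))
      (fun w => dilation k n (fun _ => w)) (fun w => dilation_mem _) (fun w j => ?_) hT
      (fun v j => by rw [bind₁_C_right])
    rw [mul_val_coord, dilation_coord, map_mul, bind₁_C_right, bind₁_X_right, hT, map_add,
      bind₁_X_right, dilation_coord, map_mul, bind₁_C_right, bind₁_C_right]
    ring
  simpa using mul_mem this (linearSubgroup_le_TLIN hL)

theorem TLIN_eq_TA {c : k} (hc0 : c ≠ 0) (hc1 : c ≠ 1) : TLIN k n = TA k n := by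
  refine le_antisymm TLIN_le_TA ((Subgroup.closure_le _).mpr ?_)
  rintro F (hF | hF)
  · exact hF.mem_TLIN hc0 hc1
  · exact hF.mem_TLIN hc0 hc1

theorem TLIN_le_GLIN : TLIN k n ≤ GLIN k n := by
  refine Subgroup.map_le_iff_le_comap.mpr ?_
  have : (GLIN k n).Normal := Subgroup.normalClosure_normal
  exact Subgroup.normalClosure_le_normal fun A hA => Subgroup.subset_normalClosure hA

theorem GLIN_le_GTAM : GLIN k n ≤ GTAM k n :=
  Subgroup.normalClosure_mono (linearSubgroup_le_TA k n)

theorem GLIN_eq_GTAM_of_TLIN_eq_TA (h : TLIN k n = TA k n) : GLIN k n = GTAM k n := by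
  refine le_antisymm GLIN_le_GTAM ?_
  have : (GLIN k n).Normal := Subgroup.normalClosure_normal
  exact Subgroup.normalClosure_le_normal (h ▸ TLIN_le_GLIN)

/-- A homomorphism on `GAₙ(k)` that kills the linear maps but not the tame maps separates both
normal closures. -/
theorem lt_of_hom {H : Type*} [Group H] (χ : GA k n →* H) (hχ : ∀ A ∈ linearSubgroup k n, χ A = 1)
    {F : GA k n} (hF : F ∈ TA k n) (hχF : χ F ≠ 1) :
    GLIN k n < GTAM k n ∧ TLIN k n < TA k n := by
  have hker : GLIN k n ≤ χ.ker := Subgroup.normalClosure_le_normal hχ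
  have hFG : F ∉ GLIN k n := fun h => hχF (hker h)
  refine ⟨lt_of_le_of_ne GLIN_le_GTAM fun h => hFG ?_,
    lt_of_le_of_ne TLIN_le_TA fun h => hFG (TLIN_le_GLIN (h ▸ hF))⟩
  rw [h]
  exact Subgroup.subset_normalClosure hF

end Scaling

/-! ### The sign of the permutation of the rational points -/

/-- The action of polynomial maps on the points of affine space. -/
noncomputable def onPoints (k : Type*) [CommRing k] (n : ℕ) :
    PolyMap k n →* Function.End (Fin n → k) where
  toFun F p i := eval p (F.coord i)
  map_one' := by
    funext p i
    simp [PolyMap.one_coord, Function.End.one_def]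
  map_mul' F G := by
    funext p i
    exact eval₂Hom_bind₁ _ _ _ _

theorem onPoints_apply {k : Type*} [CommRing k] {n : ℕ} (F : PolyMap k n) (p : Fin n → k)
    (i : Fin n) : onPoints k n F p i = eval p (F.coord i) := rfl

/-- The sign of the permutation of `kⁿ` induced by a polynomial automorphism. -/
noncomputable def pointSign (k : Type*) [CommRing k] [Fintype k] [DecidableEq k] (n : ℕ) :
    GA k n →* ℤˣ :=
  Equiv.Perm.sign.comp
    ((Equiv.Perm.equivUnitsEnd (α := Fin n → k)).symm.toMonoidHom.comp (Units.map (onPoints k n)))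

theorem transvection_mul_self {n : ℕ} {i j : Fin n} (h : i ≠ j) :
    Matrix.transvection i j (1 : ZMod 2) * Matrix.transvection i j 1 = 1 := by
  rw [Matrix.transvection_mul_transvection_same i j h, show (1 : ZMod 2) + 1 = 0 from rfl,
    Matrix.transvection_zero]

/-- The transvection over `𝔽₂` as an invertible matrix. -/
def glTransvection {n : ℕ} (i j : Fin n) (h : i ≠ j) : Matrix.GeneralLinearGroup (Fin n) (ZMod 2) :=
  ⟨Matrix.transvection i j 1, Matrix.transvection i j 1, transvection_mul_self h,
    transvection_mul_self h⟩

/-- The group `GLₙ(𝔽₂)` is generated by transvections, because an invertible diagonal matrix over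
`𝔽₂` is the identity. -/
theorem hom_eq_one_of_transvection {n : ℕ} {H : Type*} [Group H]
    (f : Matrix.GeneralLinearGroup (Fin n) (ZMod 2) →* H)
    (hf : ∀ i j (h : i ≠ j), f (glTransvection i j h) = 1)
    (A : Matrix.GeneralLinearGroup (Fin n) (ZMod 2)) : f A = 1 := by
  have main : ∀ M : Matrix (Fin n) (Fin n) (ZMod 2), M.det ≠ 0 →
      ∀ A : Matrix.GeneralLinearGroup (Fin n) (ZMod 2), A.val = M → f A = 1 := by
    intro M hM
    have hcase : ∀ x : ZMod 2, x = 0 ∨ x = 1 := by decide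
    refine Matrix.diagonal_transvection_induction_of_det_ne_zero
      (fun M => ∀ A : Matrix.GeneralLinearGroup (Fin n) (ZMod 2), A.val = M → f A = 1) M hM ?_ ?_ ?_
    · intro D hD A hA
      rw [Matrix.det_diagonal, Finset.prod_ne_zero_iff] at hD
      have : A = 1 := Units.ext <| by
        rw [hA, Units.val_one, ← Matrix.diagonal_one]
        congr 1
        funext i
        exact (hcase (D i)).resolve_left (hD i (Finset.mem_univ i))
      rw [this, map_one]
    · intro t A hA
      rcases hcase t.c with hc | hc
      · have : A = 1 := Units.ext <| by
          rw [hA, Matrix.TransvectionStruct.toMatrix, hc, Matrix.transvection_zero]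
          rfl
        rw [this, map_one]
      · have : A = glTransvection t.i t.j t.hij := Units.ext <| by
          rw [hA, Matrix.TransvectionStruct.toMatrix, hc]
          rfl
        rw [this, hf]
    · intro A B hA hB hPA hPB C hC
      obtain ⟨A', rfl⟩ := (Matrix.isUnit_iff_isUnit_det A).mpr (IsUnit.mk0 _ hA)
      obtain ⟨B', rfl⟩ := (Matrix.isUnit_iff_isUnit_det B).mpr (IsUnit.mk0 _ hB)
      have : C = A' * B' := Units.ext hC
      rw [this, map_mul, hPA A' rfl, hPB B' rfl, mul_one]
  refine main A ?_ A rfl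
  exact ((Matrix.isUnit_iff_isUnit_det A.val).mp A.isUnit).ne_zero

/-- For `n ≠ 2` the group `GLₙ(𝔽₂)` has no nontrivial homomorphism to a commutative group, because
its transvections are commutators. -/
theorem hom_eq_one_of_ne_two {n : ℕ} (hn : n ≠ 2) {H : Type*} [CommGroup H]
    (f : Matrix.GeneralLinearGroup (Fin n) (ZMod 2) →* H)
    (A : Matrix.GeneralLinearGroup (Fin n) (ZMod 2)) : f A = 1 := by
  refine hom_eq_one_of_transvection f (fun i j h => ?_) A
  obtain ⟨l, hli, hlj⟩ : ∃ l : Fin n, l ≠ i ∧ l ≠ j := by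
    by_contra! hl
    have hsub : (Finset.univ : Finset (Fin n)) = {i, j} := by
      ext l
      simp only [Finset.mem_univ, Finset.mem_insert, Finset.mem_singleton, true_iff]
      exact or_iff_not_imp_left.mpr (hl l)
    apply hn
    rw [← Finset.card_fin n, hsub, Finset.card_pair h]
  have hcomm : glTransvection i j h = glTransvection i l hli.symm * glTransvection l j hlj *
      (glTransvection i l hli.symm)⁻¹ * (glTransvection l j hlj)⁻¹ := by
    rw [eq_mul_inv_iff_mul_eq, eq_mul_inv_iff_mul_eq]
    refine Units.ext ?_
    change Matrix.transvection i j 1 * Matrix.transvection l j 1 * Matrix.transvection i l 1 =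
      Matrix.transvection i l 1 * Matrix.transvection l j (1 : ZMod 2)
    simp only [Matrix.transvection, mul_add, add_mul, mul_one, one_mul,
      Matrix.single_mul_single_same, Matrix.single_mul_single_of_ne, ne_eq, h.symm, hlj.symm,
      not_false_eq_true, add_zero]
    abel
  rw [hcomm]
  simp

/-- For `n ≠ 2` linear automorphisms over `𝔽₂` permute the points evenly. -/
theorem pointSign_linear {n : ℕ} (hn : n ≠ 2) {A : GA (ZMod 2) n}
    (hA : A ∈ linearSubgroup (ZMod 2) n) : pointSign (ZMod 2) n A = 1 := by
  obtain ⟨A, rfl⟩ := hA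
  exact hom_eq_one_of_ne_two hn ((pointSign (ZMod 2) n).comp (Units.map (linearMap (ZMod 2) n))) A

section Shear

variable {k : Type*} [CommRing k] {n : ℕ}

/-- The polynomial map adding `c X^α` to the `i`-th coordinate. -/
noncomputable def addMonomial (i : Fin n) (α : Fin n →₀ ℕ) (c : k) : PolyMap k n :=
  ⟨Function.update X i (X i + monomial α c)⟩

theorem addMonomial_mul {i : Fin n} {α : Fin n →₀ ℕ} (hα : α i = 0) (c d : k) :
    addMonomial i α c * addMonomial i α d = addMonomial i α (c + d) := by
  have hne : ∀ e j, j ≠ i → (addMonomial i α e : PolyMap k n).coord j = X j := fun e j hj =>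
    Function.update_of_ne hj _ _
  have heq : ∀ e, (addMonomial i α e : PolyMap k n).coord i = X i + monomial α e := fun e =>
    Function.update_self ..
  refine PolyMap.ext (funext fun j => ?_)
  rw [PolyMap.mul_coord]
  rcases eq_or_ne j i with rfl | h
  · rw [heq, heq, map_add, bind₁_monomial_of_eq_X hα c (hne d), bind₁_X_right, heq, map_add]
    ring
  · rw [hne _ j h, hne _ j h, bind₁_X_right, hne _ j h]

/-- The elementary automorphism `E_{i,α}`. -/
noncomputable def elementary (i : Fin n) (α : Fin n →₀ ℕ) (hα : α i = 0) : GA k n where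
  val := addMonomial i α 1
  inv := addMonomial i α (-1)
  val_inv := by
    rw [addMonomial_mul hα, add_neg_cancel]
    refine PolyMap.ext (funext fun j => ?_)
    simp [addMonomial, PolyMap.one_coord]
  inv_val := by
    rw [addMonomial_mul hα, neg_add_cancel]
    refine PolyMap.ext (funext fun j => ?_)
    simp [addMonomial, PolyMap.one_coord]

theorem elementary_mem_TA (i : Fin n) (α : Fin n →₀ ℕ) (hα : α i = 0) :
    (elementary i α hα : GA k n) ∈ TA k n := by
  refine Subgroup.subset_closure (Or.inr ⟨i, α, hα, ?_, fun j hj => ?_⟩)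
  · simp [elementary, addMonomial]
  · simp [elementary, addMonomial, hj]

end Shear

/-- The automorphism `X_i ↦ X_i + ∏_{j ≠ i} X_j` of affine space over `𝔽₂` exchanges exactly two
points, namely the two points all of whose coordinates other than the `i`-th are `1`. -/
theorem pointSign_elementary {n : ℕ} (i : Fin n) {α : Fin n →₀ ℕ} (hα : α i = 0)
    (hα' : ∀ j, j ≠ i → α j = 1) :
    pointSign (ZMod 2) n (elementary i α hα) = -1 := by
  set a : Fin n → ZMod 2 := fun _ => 1
  set b : Fin n → ZMod 2 := Function.update a i 0 with hb
  have hab : a ≠ b := fun h => by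
    simpa [a, hb] using congrFun h i
  rw [← Equiv.Perm.sign_swap hab]
  refine congrArg Equiv.Perm.sign (Equiv.ext fun p => ?_)
  have hcase : ∀ x : ZMod 2, x = 0 ∨ x = 1 := by decide
  have hne : ∀ j, j ≠ i → onPoints (ZMod 2) n (addMonomial i α 1) p j = p j := fun j hj => by
    simp [onPoints_apply, addMonomial, Function.update_of_ne hj]
  have heq : onPoints (ZMod 2) n (addMonomial i α 1) p i = p i + ∏ j, p j ^ α j := by
    simp [onPoints_apply, addMonomial, eval_monomial, Finsupp.prod_fintype]
  change onPoints (ZMod 2) n (addMonomial i α 1) p = Equiv.swap a b p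
  by_cases hp : ∀ j, j ≠ i → p j = 1
  · have hprod : ∏ j, p j ^ α j = 1 := Finset.prod_eq_one fun j _ => by
      rcases eq_or_ne j i with rfl | h
      · rw [hα, pow_zero]
      · rw [hp j h, one_pow]
    rw [hprod] at heq
    rcases hcase (p i) with h0 | h1
    · have hpb : p = b := funext fun j => by
        rcases eq_or_ne j i with rfl | h
        · simp [hb, h0]
        · simp [hb, h, a, hp j h]
      rw [hpb, Equiv.swap_apply_right, ← hpb]
      funext j
      rcases eq_or_ne j i with rfl | h
      · rw [heq, h0, zero_add]
      · rw [hne j h, hp j h]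
    · have hpa : p = a := funext fun j => by
        rcases eq_or_ne j i with rfl | h
        · exact h1
        · exact hp j h
      rw [hpa, Equiv.swap_apply_left, ← hpa]
      funext j
      rcases eq_or_ne j i with rfl | h
      · rw [heq, h1, hb, Function.update_self]
        rfl
      · rw [hne j h, hp j h, hb, Function.update_of_ne h]
  · push Not at hp
    obtain ⟨l, hl, hpl⟩ := hp
    rw [Equiv.swap_apply_of_ne_of_ne]
    · funext j
      rcases eq_or_ne j i with rfl | h
      · rw [heq, Finset.prod_eq_zero (Finset.mem_univ l), add_zero]
        rw [hα' l hl, pow_one]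
        exact (hcase _).resolve_right hpl
      · exact hne j h
    · rintro rfl
      exact hpl rfl
    · rintro rfl
      exact hpl (by rw [hb, Function.update_of_ne hl])

theorem lt_of_ne_two {n : ℕ} (hn : 1 ≤ n) (hn2 : n ≠ 2) :
    GLIN (ZMod 2) n < GTAM (ZMod 2) n ∧ TLIN (ZMod 2) n < TA (ZMod 2) n := by
  have hα : (Finsupp.equivFunOnFinite.symm
      (fun j : Fin n => if j = ⟨0, hn⟩ then 0 else 1) : Fin n →₀ ℕ) ⟨0, hn⟩ = 0 := by simp
  refine lt_of_hom (pointSign (ZMod 2) n) (fun A hA => pointSign_linear hn2 hA)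
    (elementary_mem_TA ⟨0, hn⟩ _ hα) ?_
  rw [pointSign_elementary _ hα fun j hj => by simp [hj]]
  decide

end PolyAut

namespace PolyAut

open Polynomial

/-! ### Extending a derivation to the fraction field -/

section FractionDerivation

variable {R A F : Type*} [CommRing R] [CommRing A] [Field F] [Algebra R A]
  [Algebra A F] [Algebra R F] [IsScalarTower R A F] [IsFractionRing A F]

/-- A derivation `D` as the ring homomorphism `a ↦ a + D a ε` into dual numbers over the fraction
field. -/
noncomputable def dualNumberHom (D : Derivation R A A) : A →ₐ[R] TrivSqZeroExt F F :=
  AlgHom.ofLinearMap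
    ((TrivSqZeroExt.inlAlgHom R F F).toLinearMap ∘ₗ (IsScalarTower.toAlgHom R A F).toLinearMap +
      (TrivSqZeroExt.inrHom F F).restrictScalars R ∘ₗ
        (IsScalarTower.toAlgHom R A F).toLinearMap ∘ₗ D.toLinearMap)
    (by ext <;> simp)
    (fun a b => by
      ext
      · simp
      · simp only [LinearMap.add_apply, LinearMap.comp_apply, AlgHom.toLinearMap_apply,
          TrivSqZeroExt.inlAlgHom_apply, IsScalarTower.toAlgHom_apply,
          LinearMap.coe_restrictScalars, TrivSqZeroExt.inrHom_apply, Derivation.coeFn_coe,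
          Derivation.leibniz, smul_eq_mul, map_add, map_mul,
          TrivSqZeroExt.snd_add, TrivSqZeroExt.snd_mul, TrivSqZeroExt.snd_inl,
          TrivSqZeroExt.snd_inr, TrivSqZeroExt.fst_add, TrivSqZeroExt.fst_inl,
          TrivSqZeroExt.fst_inr, MulOpposite.smul_eq_mul_unop, MulOpposite.unop_op]
        ring)

variable (F) in
theorem dualNumberHom_isUnit (D : Derivation R A A) (y : nonZeroDivisors A) :
    IsUnit ((dualNumberHom D : A →ₐ[R] TrivSqZeroExt F F) y) := by
  rw [TrivSqZeroExt.isUnit_iff_isUnit_fst]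
  have : TrivSqZeroExt.fst ((dualNumberHom D : A →ₐ[R] TrivSqZeroExt F F) y) =
      algebraMap A F y := by simp [dualNumberHom]
  rw [this]
  exact IsLocalization.map_units F y

variable (F) in
/-- The lift of `a ↦ a + D a ε` to the fraction field. -/
noncomputable def dualNumberLift (D : Derivation R A A) : F →ₐ[R] TrivSqZeroExt F F :=
  IsLocalization.liftAlgHom (M := nonZeroDivisors A) (f := dualNumberHom D)
    (dualNumberHom_isUnit F D)

theorem dualNumberLift_algebraMap (D : Derivation R A A) (a : A) :
    dualNumberLift F D (algebraMap A F a) = dualNumberHom D a := by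
  simp [dualNumberLift]

theorem fst_dualNumberLift (D : Derivation R A A) (x : F) : (dualNumberLift F D x).fst = x := by
  have : ((TrivSqZeroExt.fstHom R F F).comp (dualNumberLift F D)) = AlgHom.id R F := by
    refine IsLocalization.algHom_ext (nonZeroDivisors A) ?_
    ext a
    change (dualNumberLift F D (algebraMap A F a)).fst = algebraMap A F a
    simp [dualNumberLift_algebraMap, dualNumberHom]
  exact DFunLike.congr_fun this x

variable (F) in
/-- The extension of a derivation of a domain to the fraction field. -/
noncomputable def fractionDerivation (D : Derivation R A A) : Derivation R F F :=
  Derivation.mk'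
    (((TrivSqZeroExt.sndHom F F).restrictScalars R) ∘ₗ (dualNumberLift F D).toLinearMap)
    (fun x y => by
      simp [fst_dualNumberLift, mul_comm y])

@[simp]
theorem fractionDerivation_algebraMap (D : Derivation R A A) (a : A) :
    fractionDerivation F D (algebraMap A F a) = algebraMap A F (D a) := by
  change (dualNumberLift F D (algebraMap A F a)).snd = _
  rw [dualNumberLift_algebraMap]
  change TrivSqZeroExt.snd (TrivSqZeroExt.inl (algebraMap A F a) +
    TrivSqZeroExt.inr (algebraMap A F (D a)) : TrivSqZeroExt F F) = _
  rw [TrivSqZeroExt.snd_add, TrivSqZeroExt.snd_inl, TrivSqZeroExt.snd_inr, zero_add]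

end FractionDerivation

/-! ### The degree filtration of a rational function field -/

section Degree

variable {K : Type*} [Field K]

variable (K) in
/-- The rational functions of degree at most `n`, including `0`. -/
noncomputable def degLE (n : ℤ) : AddSubgroup (RatFunc K) where
  carrier := {f | f = 0 ∨ f.intDegree ≤ n}
  zero_mem' := Or.inl rfl
  add_mem' := by
    rintro f g hf hg
    by_cases h0 : f + g = 0
    · exact Or.inl h0
    by_cases hg0 : g = 0
    · simpa [hg0] using hf
    by_cases hf0 : f = 0
    · simpa [hf0] using hg
    exact Or.inr ((RatFunc.intDegree_add_le hg0 h0).trans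
      (max_le (hf.resolve_left hf0) (hg.resolve_left hg0)))
  neg_mem' := by
    rintro f (rfl | hf)
    · exact Or.inl neg_zero
    · exact Or.inr (by rwa [RatFunc.intDegree_neg])

theorem mem_degLE {n : ℤ} {f : RatFunc K} : f ∈ degLE K n ↔ f = 0 ∨ f.intDegree ≤ n := Iff.rfl

theorem mem_degLE_of_ne {n : ℤ} {f : RatFunc K} (hf : f ≠ 0) : f ∈ degLE K n ↔ f.intDegree ≤ n := by
  simp [mem_degLE, hf]

theorem degLE_mono {m n : ℤ} (h : m ≤ n) {f : RatFunc K} (hf : f ∈ degLE K m) : f ∈ degLE K n :=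
  hf.imp_right fun h' => h'.trans h

theorem mul_mem_degLE {m n : ℤ} {f g : RatFunc K} (hf : f ∈ degLE K m) (hg : g ∈ degLE K n) :
    f * g ∈ degLE K (m + n) := by
  rcases eq_or_ne f 0 with rfl | hf0
  · simp [zero_mem]
  rcases eq_or_ne g 0 with rfl | hg0
  · simp [zero_mem]
  rw [mem_degLE_of_ne (mul_ne_zero hf0 hg0), RatFunc.intDegree_mul hf0 hg0]
  exact add_le_add ((mem_degLE_of_ne hf0).mp hf) ((mem_degLE_of_ne hg0).mp hg)

theorem intDegree_pow {f : RatFunc K} (hf : f ≠ 0) (n : ℕ) :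
    (f ^ n).intDegree = n * f.intDegree := by
  induction n with
  | zero => simp
  | succ n ih =>
    rw [pow_succ, RatFunc.intDegree_mul (pow_ne_zero n hf) hf, ih]
    push_cast
    ring

theorem C_mem_degLE (c : K) : RatFunc.C c ∈ degLE K 0 := Or.inr (RatFunc.intDegree_C c).le

theorem algebraMap_mem_degLE (p : K[X]) {n : ℕ} (h : p.natDegree ≤ n) :
    algebraMap K[X] (RatFunc K) p ∈ degLE K n := Or.inr (by
  rw [RatFunc.intDegree_polynomial]
  exact_mod_cast h)

theorem inv_mem_degLE {n : ℤ} {f : RatFunc K} (h : -n ≤ f.intDegree) : f⁻¹ ∈ degLE K n := Or.inr (by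
  rw [RatFunc.intDegree_inv]
  omega)

/-- A function of degree at most `0` has a value at infinity. -/
theorem exists_residue {f : RatFunc K} (hf : f ∈ degLE K 0) :
    ∃ c : K, f - RatFunc.C c ∈ degLE K (-1) := by
  rcases hf with rfl | hf
  · exact ⟨0, by simp [zero_mem]⟩
  set A := f.num with hA
  set B := f.denom with hB
  have hB0 : B ≠ 0 := f.denom_ne_zero
  have hfAB : f = algebraMap K[X] _ A / algebraMap K[X] _ B := (RatFunc.num_div_denom f).symm
  have hdeg : A.natDegree ≤ B.natDegree := by
    have : (A.natDegree : ℤ) - B.natDegree ≤ 0 := hf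
    omega
  refine ⟨A.coeff B.natDegree / B.leadingCoeff, ?_⟩
  set c := A.coeff B.natDegree / B.leadingCoeff with hc
  have hB' : algebraMap K[X] (RatFunc K) B ≠ 0 := by simpa using hB0
  have hquot : f - RatFunc.C c = algebraMap K[X] (RatFunc K) (A - Polynomial.C c * B) *
      (algebraMap K[X] _ B)⁻¹ := by
    rw [hfAB, map_sub, map_mul, RatFunc.algebraMap_C]
    field_simp
  by_cases h0 : A - Polynomial.C c * B = 0
  · rw [hquot, h0]
    simp [zero_mem]
  have hlt : (A - Polynomial.C c * B).natDegree < B.natDegree := by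
    have hle : (A - Polynomial.C c * B).natDegree ≤ B.natDegree :=
      (natDegree_sub_le _ _).trans (max_le hdeg (natDegree_C_mul_le _ _))
    refine lt_of_le_of_ne hle fun heq => ?_
    apply h0
    rw [← leadingCoeff_eq_zero, leadingCoeff, heq, coeff_sub, coeff_C_mul, hc]
    have := leadingCoeff_ne_zero.mpr hB0
    rw [coeff_natDegree]
    field_simp
    ring
  rw [hquot]
  have h1 : algebraMap K[X] (RatFunc K) (A - Polynomial.C c * B) ∈
      degLE K (B.natDegree - 1) := Or.inr (by
    rw [RatFunc.intDegree_polynomial]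
    omega)
  have h2 : (algebraMap K[X] (RatFunc K) B)⁻¹ ∈ degLE K (-B.natDegree) := inv_mem_degLE (by
    rw [RatFunc.intDegree_polynomial]
    omega)
  exact degLE_mono (by omega) (mul_mem_degLE h1 h2)

/-- A function with a nonzero value at infinity has degree `0`. -/
theorem intDegree_eq_zero_of_residue {f : RatFunc K} {c : K} (hc : c ≠ 0)
    (h : f - RatFunc.C c ∈ degLE K (-1)) : f ≠ 0 ∧ f.intDegree = 0 := by
  have hC : RatFunc.C c ≠ 0 := by simpa using hc
  have hf0 : f ∈ degLE K 0 := by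
    have := add_mem (degLE_mono (by norm_num) h) (C_mem_degLE c)
    simpa using this
  have hnot : f ∉ degLE K (-1) := fun hf => by
    have hCm : RatFunc.C c ∈ degLE K (-1) := by
      simpa using sub_mem hf h
    rw [mem_degLE_of_ne hC, RatFunc.intDegree_C] at hCm
    omega
  have hne : f ≠ 0 := fun h0 => hnot (h0 ▸ zero_mem _)
  refine ⟨hne, ?_⟩
  rw [mem_degLE_of_ne hne] at hf0 hnot
  omega

end Degree

/-! ### Blowing up a point -/

section HomPart

variable {k : Type*} [Field k]

/-- The homogeneous part of degree `n` of a polynomial in two variables, dehomogenized with respect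
to the outer variable. -/
noncomputable def homPart (n : ℕ) : k[X][X] →ₗ[k] k[X] :=
  ∑ i ∈ Finset.range (n + 1),
    (monomial i : k →ₗ[k] k[X]) ∘ₗ (lcoeff k i) ∘ₗ ((lcoeff k[X] (n - i)).restrictScalars k)

theorem coeff_homPart (n i : ℕ) (p : k[X][X]) :
    (homPart n p).coeff i = if i ≤ n then (p.coeff (n - i)).coeff i else 0 := by
  simp [homPart, coeff_monomial]

theorem natDegree_homPart_le (n : ℕ) (p : k[X][X]) : (homPart n p).natDegree ≤ n := by
  refine natDegree_le_iff_coeff_eq_zero.mpr fun i hi => ?_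
  rw [coeff_homPart, if_neg (by omega)]

theorem homPart_ne_zero_iff {n : ℕ} {p : k[X][X]} :
    homPart n p ≠ 0 ↔ ∃ i j, i + j = n ∧ (p.coeff j).coeff i ≠ 0 := by
  constructor
  · intro h
    obtain ⟨i, hi⟩ : ∃ i, (homPart n p).coeff i ≠ 0 := by
      by_contra! h0
      exact h (Polynomial.ext h0)
    rw [coeff_homPart] at hi
    split_ifs at hi with hin
    · exact ⟨i, n - i, by omega, hi⟩
    · exact absurd rfl hi
  · rintro ⟨i, j, rfl, h⟩ h0
    apply h
    have := congrArg (fun q => q.coeff i) h0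
    simpa [coeff_homPart] using this

theorem coeff_swap (p : k[X][X]) (i j : ℕ) :
    ((Bivariate.swap p).coeff i).coeff j = (p.coeff j).coeff i := by
  induction p using Polynomial.induction_on' with
  | add p q hp hq => simp only [map_add, coeff_add, hp, hq]
  | monomial n q =>
    induction q using Polynomial.induction_on' with
    | add p q hp hq => simp only [map_add, coeff_add, hp, hq]
    | monomial m a =>
      rw [Bivariate.swap_monomial_monomial]
      simp only [coeff_monomial]
      split_ifs <;> simp_all [coeff_monomial]

theorem homPart_swap_ne_zero {n : ℕ} {p : k[X][X]} (h : homPart n p ≠ 0) :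
    homPart n (Bivariate.swap p) ≠ 0 := by
  rw [homPart_ne_zero_iff] at h ⊢
  obtain ⟨i, j, hij, h⟩ := h
  exact ⟨j, i, by omega, by rwa [coeff_swap]⟩

/-- The coefficients of the pullback `p(Y (X + c), Y)` of `p` to a chart of the blowing up of the
origin are the homogeneous parts of `p`. -/
theorem coeff_pullback (c : k) (p : k[X][X]) (n : ℕ) :
    (aevalAeval (Polynomial.X * C (Polynomial.X + C c)) (Polynomial.X : k[X][X]) p).coeff n =
      (homPart n p).comp (Polynomial.X + C c) := by
  induction p using Polynomial.induction_on' with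
  | add p q hp hq => rw [map_add, coeff_add, hp, hq, map_add, add_comp]
  | monomial j q =>
    induction q using Polynomial.induction_on' with
    | add p q hp hq => rw [map_add (monomial j), map_add, coeff_add, hp, hq, map_add, add_comp]
    | monomial i a =>
      have hL : aevalAeval (Polynomial.X * C (Polynomial.X + C c)) (Polynomial.X : k[X][X])
          (monomial j (monomial i a)) =
          monomial (i + j) (C a * (Polynomial.X + C c) ^ i) := by
        rw [← C_mul_X_pow_eq_monomial, ← C_mul_X_pow_eq_monomial, map_mul, map_pow,
          aevalAeval_Y, aevalAeval_C, map_mul, aeval_C, map_pow, aeval_X, mul_pow,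
          ← C_mul_X_pow_eq_monomial, C_mul, C_pow, pow_add]
        change C (C a) * _ * _ = _
        ring
      have hR : homPart n (monomial j (monomial i a)) = if i + j = n then monomial i a else 0 := by
        ext l
        rw [coeff_homPart, coeff_monomial]
        split_ifs <;> simp [coeff_monomial] <;> omega
      rw [hL, hR, coeff_monomial]
      split_ifs
      · rw [monomial_comp]
      · rw [zero_comp]

theorem exists_homPart_ne_zero_of_coeff_zero {m : ℕ} {p : k[X][X]} (h : p.coeff 0 ≠ 0)
    (hm : (p.coeff 0).natDegree ≤ m) : ∃ i ≤ m, homPart i p ≠ 0 :=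
  ⟨_, hm, homPart_ne_zero_iff.mpr ⟨(p.coeff 0).natDegree, 0, rfl, by
    rwa [coeff_natDegree, leadingCoeff_ne_zero]⟩⟩

/-- The strict transform `q` of `p` at the point with parameter `c` of the exceptional curve of the
blowing up of the origin. The multiplicity of `p` at the origin is `μ`, and `q` restricts to the
initial form of `p` on the exceptional curve. -/
theorem exists_strict_transform {m : ℕ} {p : k[X][X]} (hp : homPart m p ≠ 0) :
    ∃ μ ≤ m, homPart μ p ≠ 0 ∧ ∀ c : k, ∃ q : k[X][X],
      q.coeff 0 = (homPart μ p).comp (Polynomial.X + C c) ∧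
      ∀ {L : Type*} [Field L] [Algebra k L] (f g : L),
        aevalAeval (f * (g + algebraMap k L c)) f p = f ^ μ * aevalAeval g f q := by
  classical
  have hex : ∃ μ, homPart μ p ≠ 0 := ⟨m, hp⟩
  refine ⟨Nat.find hex, Nat.find_min' hex hp, Nat.find_spec hex, fun c => ?_⟩
  set μ := Nat.find hex
  obtain ⟨q, hq⟩ : (Polynomial.X : k[X][X]) ^ μ ∣
      aevalAeval (Polynomial.X * C (Polynomial.X + C c)) (Polynomial.X : k[X][X]) p := by
    rw [X_pow_dvd_iff]
    intro d hd
    rw [coeff_pullback, not_not.mp (Nat.find_min hex hd), zero_comp]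
  refine ⟨q, ?_, fun {L} _ _ f g => ?_⟩
  · have := coeff_pullback c p μ
    rw [hq] at this
    rw [← this, mul_comm]
    simpa using (coeff_mul_X_pow q μ 0).symm
  · have h1 : aevalAeval g f (aevalAeval (Polynomial.X * C (Polynomial.X + C c))
        (Polynomial.X : k[X][X]) p) = aevalAeval (f * (g + algebraMap k L c)) f p := by
      have : (aevalAeval g f).comp (aevalAeval (Polynomial.X * C (Polynomial.X + C c))
          (Polynomial.X : k[X][X])) = aevalAeval (f * (g + algebraMap k L c)) f := by
        refine (aevalAevalEquiv k L).symm.injective (Prod.ext ?_ ?_)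
        · simp [aevalAevalEquiv]
        · simp [aevalAevalEquiv]
      exact DFunLike.congr_fun this p
    rw [← h1, hq, map_mul, map_pow, aevalAeval_Y]

end HomPart

/-! ### Jacobian determinants and the blow-up bound -/

section Jacobian

variable {k L : Type*} [Field k] [Field L] [Algebra k L]

/-- The Jacobian determinant of `f` and `g` with respect to two derivations. -/
def jac (D₁ D₂ : Derivation k L L) (f g : L) : L := D₁ f * D₂ g - D₂ f * D₁ g

variable (D₁ D₂ : Derivation k L L)

theorem jac_swap (f g : L) : jac D₁ D₂ g f = -jac D₁ D₂ f g := by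
  simp only [jac]
  ring

/-- Dividing the second coordinate by the first one divides the Jacobian determinant. -/
theorem jac_blowup (f g : L) (c : k) :
    jac D₁ D₂ f (f * (g + algebraMap k L c)) = f * jac D₁ D₂ f g := by
  simp only [jac, Derivation.leibniz, map_add, Derivation.map_algebraMap, smul_eq_mul]
  ring

theorem ne_zero_of_jac_ne_zero {f g : L} (h : jac D₁ D₂ f g ≠ 0) : f ≠ 0 ∧ g ≠ 0 := by
  constructor
  · rintro rfl
    simp [jac] at h
  · rintro rfl
    simp [jac] at h

end Jacobian

section Blowup

variable {k K : Type*} [Field k] [Field K] [Algebra k K]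

theorem algebraMap_eq_C_algebraMap (c : k) :
    algebraMap k (RatFunc K) c = RatFunc.C (algebraMap k K c) := by
  rw [IsScalarTower.algebraMap_apply k K[X] (RatFunc K), Polynomial.algebraMap_apply]
  exact RatFunc.algebraMap_C _

theorem aeval_mem_degLE {f : RatFunc K} (hf : f ∈ degLE K 0) (h : k[X]) :
    aeval f h ∈ degLE K 0 := by
  induction h using Polynomial.induction_on' with
  | add p q hp hq => rw [map_add]; exact add_mem hp hq
  | monomial n a =>
    rw [aeval_monomial, algebraMap_eq_C_algebraMap]
    refine mul_mem_degLE (n := 0) (C_mem_degLE _) ?_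
    induction n with
    | zero => simpa using C_mem_degLE (1 : K)
    | succ n ih => rw [pow_succ]; exact mul_mem_degLE (n := 0) ih hf

theorem aevalAeval_mem_degLE {f g : RatFunc K} (hf : f ∈ degLE K 0) (hg : g ∈ degLE K 0)
    (p : k[X][X]) : aevalAeval f g p ∈ degLE K 0 := by
  induction p using Polynomial.induction_on' with
  | add p q hp hq => rw [map_add]; exact add_mem hp hq
  | monomial n a =>
    rw [← C_mul_X_pow_eq_monomial, map_mul, map_pow, aevalAeval_C, aevalAeval_Y]
    refine mul_mem_degLE (n := 0) (aeval_mem_degLE hf a) ?_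
    induction n with
    | zero => simpa using C_mem_degLE (1 : K)
    | succ n ih => rw [pow_succ]; exact mul_mem_degLE (n := 0) ih hg

theorem aeval_residue {f : RatFunc K} {c : K} (h : f - RatFunc.C c ∈ degLE K (-1)) (p : k[X]) :
    aeval f p - RatFunc.C (aeval c p) ∈ degLE K (-1) := by
  have hf : f ∈ degLE K 0 := by
    simpa using add_mem (degLE_mono (n := 0) (by norm_num) h) (C_mem_degLE c)
  induction p using Polynomial.induction_on' with
  | add p q hp hq =>
    rw [map_add, map_add, map_add, add_sub_add_comm]
    exact add_mem hp hq
  | monomial n a =>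
    rw [aeval_monomial, aeval_monomial, algebraMap_eq_C_algebraMap, map_mul, ← mul_sub]
    refine mul_mem_degLE (K := K) (m := 0) (n := -1) (C_mem_degLE _) ?_
    induction n with
    | zero => simp [zero_mem]
    | succ n ih =>
      have : f ^ (n + 1) - RatFunc.C (c ^ (n + 1)) =
          (f ^ n - RatFunc.C (c ^ n)) * f + RatFunc.C (c ^ n) * (f - RatFunc.C c) := by
        simp only [map_pow]
        ring
      rw [this]
      exact add_mem (mul_mem_degLE (m := -1) (n := 0) ih hf)
        (mul_mem_degLE (m := 0) (n := -1) (C_mem_degLE _) h)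

variable (D₁ D₂ : Derivation k (RatFunc K) (RatFunc K))

theorem jac_mem_degLE (h₁ : ∀ n f, f ∈ degLE K n → D₁ f ∈ degLE K n)
    (h₂ : ∀ n f, f ∈ degLE K n → D₂ f ∈ degLE K (n - 1)) {m n : ℤ} {f g : RatFunc K}
    (hf : f ∈ degLE K m) (hg : g ∈ degLE K n) : jac D₁ D₂ f g ∈ degLE K (m + n - 1) := by
  refine sub_mem (degLE_mono ?_ (mul_mem_degLE (h₁ m f hf) (h₂ n g hg)))
    (degLE_mono ?_ (mul_mem_degLE (h₂ m f hf) (h₁ n g hg))) <;> omega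

/-- Let `f` and `g` be small at infinity, and let `p` be a polynomial with a nonzero homogeneous
part of degree `m`. Then `p(g, f)` can be small only if `m` or the order of the Jacobian determinant
of `f` and `g` is large: the order of vanishing of `p(g, f)` is at most `m` times the log
discrepancy, which is the order of the Jacobian determinant diminished by one.

The proof blows up the centre of the valuation. When this centre is a rational point, the
multiplicity of the strict transform does not increase and the Jacobian determinant is divided by
`f`. Otherwise `g / f` has a transcendental value and the initial form of `p` does not vanish. The
order of the Jacobian determinant is bounded by `N`, so that the second case occurs after at most
`N` steps. -/
theorem blowup_bound
    (hres : ∀ c : K, c ∉ Set.range (algebraMap k K) → Transcendental k c)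
    (h₁ : ∀ n f, f ∈ degLE K n → D₁ f ∈ degLE K n)
    (h₂ : ∀ n f, f ∈ degLE K n → D₂ f ∈ degLE K (n - 1)) (N : ℕ) :
    ∀ (p : k[X][X]) (m : ℕ) (f g : RatFunc K), f ∈ degLE K (-1) → g ∈ degLE K (-1) →
      jac D₁ D₂ f g ≠ 0 → -(N : ℤ) ≤ (jac D₁ D₂ f g).intDegree → homPart m p ≠ 0 →
      aevalAeval g f p ≠ 0 ∧
        m * ((jac D₁ D₂ f g).intDegree + 1) ≤ (aevalAeval g f p).intDegree := by
  induction N with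
  | zero =>
    intro p m f g hf hg hJ hN
    have := (mem_degLE_of_ne hJ).mp (jac_mem_degLE D₁ D₂ h₁ h₂ hf hg)
    push_cast at hN
    omega
  | succ N ih =>
    intro p m f g hf hg hJ hN hp
    -- By symmetry `g / f` may be assumed to be finite at infinity.
    wlog hle : g.intDegree ≤ f.intDegree generalizing p f g
    · have hJ' : jac D₁ D₂ g f ≠ 0 := by rwa [jac_swap, neg_ne_zero]
      have hdeg : (jac D₁ D₂ g f).intDegree = (jac D₁ D₂ f g).intDegree := by
        rw [jac_swap, RatFunc.intDegree_neg]
      have := this (Bivariate.swap p) g f hg hf hJ' (by rwa [hdeg]) (homPart_swap_ne_zero hp)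
        (by omega)
      rwa [hdeg, Bivariate.aevalAeval_swap] at this
    obtain ⟨hf0, hg0⟩ := ne_zero_of_jac_ne_zero D₁ D₂ hJ
    have hJle := (mem_degLE_of_ne hJ).mp (jac_mem_degLE D₁ D₂ h₁ h₂
      ((mem_degLE_of_ne hf0).mpr le_rfl) ((mem_degLE_of_ne hg0).mpr le_rfl))
    have hf' := (mem_degLE_of_ne hf0).mp hf
    have hg' := (mem_degLE_of_ne hg0).mp hg
    have hgf0 : g / f ≠ 0 := div_ne_zero hg0 hf0
    have hgf : g / f ∈ degLE K 0 := by
      rw [mem_degLE_of_ne hgf0, RatFunc.intDegree_div hg0 hf0]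
      omega
    obtain ⟨c, hc⟩ := exists_residue hgf
    obtain ⟨μ, hμm, hμ, hstrict⟩ := exists_strict_transform hp
    have hμm' : (μ : ℤ) ≤ m := by exact_mod_cast hμm
    -- The value `c` of `g / f` determines the centre of the valuation on the exceptional curve.
    by_cases hck : c ∈ Set.range (algebraMap k K)
    · obtain ⟨c, rfl⟩ := hck
      obtain ⟨q, hq0, hq⟩ := hstrict c
      set g' := g / f - algebraMap k (RatFunc K) c with hg'def
      have hgeq : g = f * (g' + algebraMap k (RatFunc K) c) := by
        rw [hg'def, sub_add_cancel, mul_div_cancel₀ _ hf0]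
      have hg'mem : g' ∈ degLE K (-1) := by
        rw [hg'def, algebraMap_eq_C_algebraMap]
        exact hc
      have hJeq : jac D₁ D₂ f g = f * jac D₁ D₂ f g' := by
        conv_lhs => rw [hgeq]
        exact jac_blowup D₁ D₂ f g' c
      have hJ' : jac D₁ D₂ f g' ≠ 0 := right_ne_zero_of_mul (hJeq ▸ hJ)
      have hJdeg : (jac D₁ D₂ f g).intDegree = f.intDegree + (jac D₁ D₂ f g').intDegree := by
        rw [hJeq, RatFunc.intDegree_mul hf0 hJ']
      have hJ'le := (mem_degLE_of_ne hJ').mp (jac_mem_degLE D₁ D₂ h₁ h₂ hf hg'mem)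
      obtain ⟨m', hm', hqm'⟩ : ∃ i ≤ μ, homPart i q ≠ 0 := by
        refine exists_homPart_ne_zero_of_coeff_zero ?_ ?_
        · rw [hq0]
          intro h0
          exact hμ (by simpa using (comp_X_add_C_eq_zero_iff).mp h0)
        · rw [hq0, natDegree_comp]
          simpa using natDegree_homPart_le μ p
      obtain ⟨hne, hdeg⟩ := ih q m' f g' hf hg'mem hJ' (by push_cast at hN; omega) hqm'
      have hev : aevalAeval g f p = f ^ μ * aevalAeval g' f q := by
        conv_lhs => rw [hgeq]
        exact hq f g'
      have hfμ : f ^ μ ≠ 0 := pow_ne_zero _ hf0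
      refine ⟨hev ▸ mul_ne_zero hfμ hne, ?_⟩
      rw [hev, RatFunc.intDegree_mul hfμ hne, intDegree_pow hf0, hJdeg]
      have hm'' : (m' : ℤ) ≤ μ := by exact_mod_cast hm'
      nlinarith
    · obtain ⟨q, hq0, hq⟩ := hstrict 0
      have htr := hres c hck
      have hres0 : aeval c (homPart μ p) ≠ 0 := fun h0 => hμ (by
        by_contra hne
        exact htr ⟨_, hne, h0⟩)
      have hqeq : aevalAeval (g / f) f q =
          aeval (g / f) (homPart μ p) + f * aevalAeval (g / f) f q.divX := by
        conv_lhs => rw [← divX_mul_X_add q]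
        rw [map_add, map_mul, aevalAeval_Y, aevalAeval_C, hq0]
        simp only [map_zero, add_zero, comp_X]
        ring
      have hresq : aevalAeval (g / f) f q - RatFunc.C (aeval c (homPart μ p)) ∈ degLE K (-1) := by
        rw [hqeq, add_sub_right_comm]
        exact add_mem (aeval_residue hc _) (mul_mem_degLE (m := -1) (n := 0) hf
          (aevalAeval_mem_degLE hgf (degLE_mono (by norm_num) hf) _))
      obtain ⟨hne, hdeg⟩ := intDegree_eq_zero_of_residue hres0 hresq
      have hev : aevalAeval g f p = f ^ μ * aevalAeval (g / f) f q := by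
        rw [← hq f (g / f), map_zero, add_zero, mul_div_cancel₀ _ hf0]
      have hfμ : f ^ μ ≠ 0 := pow_ne_zero _ hf0
      refine ⟨hev ▸ mul_ne_zero hfμ hne, ?_⟩
      rw [hev, RatFunc.intDegree_mul hfμ hne, intDegree_pow hf0, hdeg]
      nlinarith

end Blowup

/-! ### Derivations of the field of rational functions in two variables -/

section CoeffDerivation

variable {R A : Type*} [CommRing R] [CommRing A] [Algebra R A]

/-- The derivation of `A[X]` that applies a derivation of `A` to the coefficients. -/
noncomputable def coeffDerivation (D : Derivation R A A) : Derivation R A[X] A[X] :=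
  PolynomialModule.equivPolynomialSelf.compDer D.mapCoeffs

theorem coeff_coeffDerivation (D : Derivation R A A) (p : A[X]) (i : ℕ) :
    (coeffDerivation D p).coeff i = D (p.coeff i) := rfl

end CoeffDerivation

section FractionDegree

variable {k K : Type*} [Field k] [Field K] [Algebra k K]

theorem fractionDerivation_mem_degLE (D : Derivation k K[X] K[X]) (e : ℤ)
    (hD : ∀ p, algebraMap K[X] (RatFunc K) (D p) ∈ degLE K (p.natDegree - e)) (n : ℤ)
    (f : RatFunc K) (hf : f ∈ degLE K n) :
    fractionDerivation (RatFunc K) D f ∈ degLE K (n - e) := by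
  rcases eq_or_ne f 0 with rfl | hf0
  · rw [map_zero]
    exact zero_mem _
  set δ := fractionDerivation (RatFunc K) D
  set A := algebraMap K[X] (RatFunc K) f.num with hA
  set B := algebraMap K[X] (RatFunc K) f.denom with hB
  have hB0 : B ≠ 0 := by simpa [hB] using f.denom_ne_zero
  have hfB : f * B = A := ((div_eq_iff hB0).mp f.num_div_denom).symm
  have hδ : δ f = δ A * B⁻¹ - f * (δ B * B⁻¹) := by
    have := congrArg δ hfB
    rw [Derivation.leibniz, smul_eq_mul, smul_eq_mul] at this
    field_simp
    rw [← this]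
    ring
  have hn := (mem_degLE_of_ne hf0).mp hf
  have hfdeg : f.intDegree = f.num.natDegree - f.denom.natDegree := rfl
  have hBinv : B⁻¹ ∈ degLE K (-f.denom.natDegree) := inv_mem_degLE (by
    rw [hB, RatFunc.intDegree_polynomial]
    omega)
  have hδA : δ A ∈ degLE K (f.num.natDegree - e) := by
    rw [hA, fractionDerivation_algebraMap]
    exact hD _
  have hδB : δ B ∈ degLE K (f.denom.natDegree - e) := by
    rw [hB, fractionDerivation_algebraMap]
    exact hD _
  rw [hδ]
  refine sub_mem (degLE_mono ?_ (mul_mem_degLE hδA hBinv))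
    (degLE_mono ?_ (mul_mem_degLE hf (mul_mem_degLE hδB hBinv))) <;> omega

end FractionDegree

section TwoVariables

variable (k : Type*) [Field k]

/-- The field `k(s, t)`, as the field of rational functions in `t` over `k(s)`; its degree is the
degree in `t`. -/
abbrev Field₂ := RatFunc (RatFunc k)

/-- The inclusion of `k[s, t]`, the ring of polynomials in `t` over `k[s]`, in its fraction
field. -/
noncomputable def toField : k[X][X] →ₐ[k] Field₂ k :=
  (IsScalarTower.toAlgHom k (RatFunc k)[X] (Field₂ k)).comp
    (mapAlgHom (IsScalarTower.toAlgHom k k[X] (RatFunc k)))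

/-- The partial derivative of `k(s, t)` with respect to `s`. -/
noncomputable def derivS : Derivation k (Field₂ k) (Field₂ k) :=
  fractionDerivation (Field₂ k) (coeffDerivation
    (fractionDerivation (RatFunc k) (derivative' (R := k))))

/-- The partial derivative of `k(s, t)` with respect to `t`. -/
noncomputable def derivT : Derivation k (Field₂ k) (Field₂ k) :=
  fractionDerivation (Field₂ k) ((derivative' (R := RatFunc k)).restrictScalars k)

variable {k}

theorem toField_apply (p : k[X][X]) : toField k p =
    algebraMap (RatFunc k)[X] (Field₂ k) (p.map (algebraMap k[X] (RatFunc k))) := rfl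

theorem intDegree_toField (p : k[X][X]) : (toField k p).intDegree = p.natDegree := by
  rw [toField_apply, RatFunc.intDegree_polynomial,
    natDegree_map_eq_of_injective (IsFractionRing.injective k[X] (RatFunc k))]

theorem toField_injective : Function.Injective (toField k) := fun p q h => by
  rw [toField_apply, toField_apply] at h
  exact map_injective _ (IsFractionRing.injective k[X] (RatFunc k))
    (IsFractionRing.injective (RatFunc k)[X] (Field₂ k) h)

theorem derivS_toField (p : k[X][X]) :
    derivS k (toField k p) = toField k (coeffDerivation (derivative' (R := k)) p) := by
  rw [toField_apply, derivS, fractionDerivation_algebraMap, toField_apply]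
  congr 1
  ext i
  rw [coeff_coeffDerivation, coeff_map, coeff_map, fractionDerivation_algebraMap,
    coeff_coeffDerivation]

theorem derivT_toField (p : k[X][X]) : derivT k (toField k p) = toField k (derivative p) := by
  rw [toField_apply, derivT, fractionDerivation_algebraMap, toField_apply, ← derivative_map]
  rfl

theorem derivS_mem_degLE (n : ℤ) (f : Field₂ k) (hf : f ∈ degLE _ n) : derivS k f ∈ degLE _ n := by
  have := fractionDerivation_mem_degLE (coeffDerivation
    (fractionDerivation (RatFunc k) (derivative' (R := k)))) 0 (fun p => ?_) n f hf
  · rwa [sub_zero] at this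
  · rw [sub_zero]
    refine algebraMap_mem_degLE _ (natDegree_le_iff_coeff_eq_zero.mpr fun i hi => ?_)
    rw [coeff_coeffDerivation, coeff_eq_zero_of_natDegree_lt hi, map_zero]

theorem derivT_mem_degLE (n : ℤ) (f : Field₂ k) (hf : f ∈ degLE _ n) :
    derivT k f ∈ degLE _ (n - 1) := by
  refine fractionDerivation_mem_degLE _ 1 (fun p => ?_) n f hf
  change algebraMap _ _ (derivative p) ∈ _
  by_cases h0 : derivative p = 0
  · rw [h0, map_zero]
    exact zero_mem _
  · have hp : p.natDegree ≠ 0 := fun h => h0 (derivative_of_natDegree_zero h)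
    have := natDegree_derivative_lt hp
    exact degLE_mono (by omega) (algebraMap_mem_degLE (derivative p) le_rfl)

/-- The chain rule, in the form that the Jacobian matrix of a polynomial expression factors through
that of its arguments. -/
theorem exists_chain_rule (x y : k[X][X]) (P : MvPolynomial (Fin 2) k) :
    ∃ a b : k[X][X], ∀ D : Derivation k (Field₂ k) (Field₂ k),
      D (toField k (MvPolynomial.aeval ![x, y] P)) =
        toField k a * D (toField k x) + toField k b * D (toField k y) := by
  induction P using MvPolynomial.induction_on with
  | C c =>
    refine ⟨0, 0, fun D => ?_⟩
    rw [MvPolynomial.aeval_C, AlgHom.commutes, D.map_algebraMap]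
    simp
  | add p q hp hq =>
    obtain ⟨a, b, h⟩ := hp
    obtain ⟨a', b', h'⟩ := hq
    refine ⟨a + a', b + b', fun D => ?_⟩
    simp only [map_add, h, h']
    ring
  | mul_X p i hp =>
    obtain ⟨a, b, h⟩ := hp
    set e := MvPolynomial.aeval ![x, y] p
    fin_cases i
    · refine ⟨x * a + e, x * b, fun D => ?_⟩
      have : MvPolynomial.aeval ![x, y] (p * MvPolynomial.X 0) = e * x := by simp [e]
      change D (toField k (MvPolynomial.aeval ![x, y] (p * MvPolynomial.X 0))) = _
      rw [this, map_mul, D.leibniz, h]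
      simp only [map_add, map_mul, smul_eq_mul]
      ring
    · refine ⟨y * a, y * b + e, fun D => ?_⟩
      have : MvPolynomial.aeval ![x, y] (p * MvPolynomial.X 1) = e * y := by simp [e]
      change D (toField k (MvPolynomial.aeval ![x, y] (p * MvPolynomial.X 1))) = _
      rw [this, map_mul, D.leibniz, h]
      simp only [map_add, map_mul, smul_eq_mul]
      ring

/-- The Jacobian determinant of a pair of generators of `k[s, t]` is a unit. -/
theorem jac_of_generators {x y : k[X][X]} {P Q : MvPolynomial (Fin 2) k}
    (hP : MvPolynomial.aeval ![x, y] P = C X) (hQ : MvPolynomial.aeval ![x, y] Q = X) :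
    jac (derivS k) (derivT k) (toField k x) (toField k y) ≠ 0 ∧
      (jac (derivS k) (derivT k) (toField k x) (toField k y)).intDegree = 0 := by
  obtain ⟨a, b, h⟩ := exists_chain_rule x y P
  obtain ⟨a', b', h'⟩ := exists_chain_rule x y Q
  rw [hP] at h
  rw [hQ] at h'
  have hSs : derivS k (toField k (C X)) = 1 := by
    rw [derivS_toField]
    have : coeffDerivation (derivative' (R := k)) (C X) = (1 : k[X][X]) := by
      ext1 i
      rw [coeff_coeffDerivation, coeff_C, coeff_one]
      split_ifs <;> simp
    rw [this, map_one]
  have hSt : derivS k (toField k X) = 0 := by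
    rw [derivS_toField]
    have : coeffDerivation (derivative' (R := k)) (X : k[X][X]) = 0 := by
      ext1 i
      rw [coeff_coeffDerivation, coeff_X, coeff_zero]
      split_ifs <;> simp
    rw [this, map_zero]
  have hTs : derivT k (toField k (C X)) = 0 := by rw [derivT_toField, derivative_C, map_zero]
  have hTt : derivT k (toField k X) = 1 := by rw [derivT_toField, derivative_X, map_one]
  set j := jac (derivS k) (derivT k) (toField k x) (toField k y) with hj
  have hone : toField k (a * b' - b * a') * j = 1 := by
    have : jac (derivS k) (derivT k) (toField k (C X)) (toField k X) = 1 := by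
      rw [jac, hSs, hTt, hTs, zero_mul, sub_zero, mul_one]
    rw [jac, h, h, h', h'] at this
    rw [← this, hj, jac, map_sub, map_mul, map_mul]
    ring
  have hjR : j = toField k (coeffDerivation (derivative' (R := k)) x * derivative y -
      derivative x * coeffDerivation (derivative' (R := k)) y) := by
    rw [hj, jac, derivS_toField, derivS_toField, derivT_toField, derivT_toField, map_sub, map_mul,
      map_mul]
  have hj0 : j ≠ 0 := right_ne_zero_of_mul (hone ▸ one_ne_zero)
  refine ⟨hj0, ?_⟩
  have hdeg := congrArg RatFunc.intDegree hone
  rw [RatFunc.intDegree_mul (left_ne_zero_of_mul (hone ▸ one_ne_zero)) hj0,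
    RatFunc.intDegree_one, intDegree_toField] at hdeg
  have h0 : 0 ≤ j.intDegree := by
    rw [hjR, intDegree_toField]
    omega
  omega

end TwoVariables

/-! ### The degrees of a pair of generators divide one another -/

section LogDerivative

variable {k L : Type*} [Field k] [Field L] [Algebra k L] (D : Derivation k L L)

theorem logDeriv_pow {x : L} (hx : x ≠ 0) (n : ℕ) : D (x ^ n) = x ^ n * (n * (D x / x)) := by
  rw [Derivation.leibniz_pow]
  rcases n with _ | n
  · simp
  · rw [Nat.add_sub_cancel, smul_eq_mul, nsmul_eq_mul, pow_succ]
    field_simp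

theorem logDeriv_div {x y : L} (hx : x ≠ 0) (hy : y ≠ 0) (m n : ℕ) :
    D (x ^ m / y ^ n) = x ^ m / y ^ n * (m * (D x / x) - n * (D y / y)) := by
  have h : D (x ^ m / y ^ n * y ^ n) = D (x ^ m) := by
    rw [div_mul_cancel₀ _ (pow_ne_zero n hy)]
  rw [Derivation.leibniz, logDeriv_pow D hx, logDeriv_pow D hy, smul_eq_mul, smul_eq_mul] at h
  have hyn : y ^ n ≠ 0 := pow_ne_zero n hy
  have h2 : y ^ n * D (x ^ m / y ^ n) =
      x ^ m * (m * (D x / x)) - x ^ m / y ^ n * (y ^ n * (n * (D y / y))) := by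
    rw [← h]
    ring
  apply mul_left_cancel₀ hyn
  rw [h2]
  field_simp

/-- The Jacobian determinant of two monomials with exponent determinant `1`. -/
theorem jac_monomials (D₁ D₂ : Derivation k L L) {x y : L} (hx : x ≠ 0) (hy : y ≠ 0)
    {a b μ ν : ℕ} (h : ν * b = a * μ + 1) :
    jac D₁ D₂ (x ^ μ / y ^ ν) (x ^ b / y ^ a) * (x * y) =
      x ^ μ / y ^ ν * (x ^ b / y ^ a) * jac D₁ D₂ x y := by
  have hL : (ν : L) * b = a * μ + 1 := by exact_mod_cast congrArg (Nat.cast (R := L)) h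
  have hD : ∀ (D : Derivation k L L) {w : L}, w ≠ 0 → D w = w * (D w / w) := fun D w hw => by
    field_simp
  simp only [jac, logDeriv_div _ hx hy]
  rw [hD D₁ hx, hD D₁ hy, hD D₂ hx, hD D₂ hy]
  simp only [mul_div_cancel_left₀ _ hx, mul_div_cancel_left₀ _ hy]
  generalize x ^ μ / y ^ ν = p
  generalize x ^ b / y ^ a = q
  linear_combination
    p * q * x * y * (D₁ x / x * (D₂ y / y) - D₂ x / x * (D₁ y / y)) * hL

end LogDerivative

section WeightedLeadingForm

variable {k : Type*} [Field k]

/-- The polynomial `p(u, τ)` with `p(z - 1, τ) = τ^N P(τ^(-a) z^ν, τ^(-b) z^μ)`, where `N` is at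
least the weighted degree of `P`. It describes `P` near a point at infinity of the weighted
projective plane. -/
noncomputable def atInfinity (a b μ ν N : ℕ) (P : MvPolynomial (Fin 2) k) : k[X][X] :=
  ∑ α ∈ P.support, monomial (N - (a * α 0 + b * α 1))
    (C (P.coeff α) * (X + C 1) ^ (ν * α 0 + μ * α 1))

theorem aevalAeval_atInfinity {L : Type*} [Field L] [Algebra k L] {a b μ ν N : ℕ}
    {P : MvPolynomial (Fin 2) k} (hN : ∀ α ∈ P.support, a * α 0 + b * α 1 ≤ N)
    {x y τ z : L} (hx : x * τ ^ a = z ^ ν) (hy : y * τ ^ b = z ^ μ) :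
    aevalAeval (z - 1) τ (atInfinity a b μ ν N P) = τ ^ N * MvPolynomial.aeval ![x, y] P := by
  rw [atInfinity, map_sum, MvPolynomial.aeval_def, MvPolynomial.eval₂_eq', Finset.mul_sum]
  refine Finset.sum_congr rfl fun α hα => ?_
  rw [← C_mul_X_pow_eq_monomial, map_mul, map_pow, aevalAeval_Y, aevalAeval_C, map_mul, aeval_C,
    map_pow, map_add, aeval_X, aeval_C, map_one, sub_add_cancel, Fin.prod_univ_two, pow_add,
    pow_mul, pow_mul, ← hx, ← hy]
  have hτ : τ ^ N = τ ^ (N - (a * α 0 + b * α 1)) * (τ ^ (a * α 0) * τ ^ (b * α 1)) := by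
    rw [← pow_add, ← pow_add, Nat.sub_add_cancel (hN α hα)]
  rw [hτ, mul_pow, mul_pow, ← pow_mul, ← pow_mul]
  simp only [Matrix.cons_val_zero, Matrix.cons_val_one]
  ring

/-- The multiplicity at the origin of the polynomial `atInfinity a b μ ν N P` is at most
`N / (a b)`: the weighted leading form of `P` is, up to a monomial, a polynomial of degree at most
`N / (a b)` in `z = x ^ b / y ^ a`, so it vanishes to at most this order at `z = 1`. -/
theorem exists_homPart_atInfinity {a b μ ν N : ℕ} (h : ν * b = a * μ + 1)
    {P : MvPolynomial (Fin 2) k} (hN : ∀ α ∈ P.support, a * α 0 + b * α 1 ≤ N)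
    (hN' : ∃ α ∈ P.support, a * α 0 + b * α 1 = N) :
    ∃ m, a * b * m ≤ N ∧ homPart m (atInfinity a b μ ν N P) ≠ 0 := by
  classical
  set S := P.support.filter (fun α => a * α 0 + b * α 1 = N) with hS
  set w : k[X] := ∑ α ∈ S, monomial (ν * α 0 + μ * α 1) (P.coeff α) with hw
  have hcoeff : (atInfinity a b μ ν N P).coeff 0 = w.comp (X + C 1) := by
    rw [atInfinity, finsetSum_coeff, ← coe_compRingHom_apply, hw, map_sum, hS, Finset.sum_filter]
    simp only [coe_compRingHom_apply]
    refine Finset.sum_congr rfl fun α hα => ?_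
    have := hN α hα
    rw [coeff_monomial]
    split_ifs with h1 h2 h2
    · rw [monomial_comp]
    · omega
    · omega
    · rfl
  -- On the line `a i + b j = N`, the exponent `e = ν i + μ j` determines `i` and `j`.
  have hline : ∀ i j e : ℕ, a * i + b * j = N → ν * i + μ * j = e →
      (b * e : ℤ) = i + μ * N ∧ (a * e : ℤ) = ν * N - j := by
    intro i j e h1 h2
    have h' : (ν * b : ℤ) = a * μ + 1 := by exact_mod_cast h
    have h1' : (a * i + b * j : ℤ) = N := by exact_mod_cast h1
    have h2' : (ν * i + μ * j : ℤ) = e := by exact_mod_cast h2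
    constructor
    · rw [← h1', ← h2']
      linear_combination (i : ℤ) * h'
    · rw [← h1', ← h2']
      linear_combination -(j : ℤ) * h'
  have hwcoeff : ∀ e, w.coeff e ≠ 0 → ∃ i j : ℕ, a * i + b * j = N ∧ ν * i + μ * j = e := by
    intro e he
    rw [hw, finsetSum_coeff] at he
    obtain ⟨α, hα, hne⟩ := Finset.exists_ne_zero_of_sum_ne_zero he
    rw [coeff_monomial] at hne
    split_ifs at hne with h1
    · exact ⟨α 0, α 1, (Finset.mem_filter.mp hα).2, h1⟩
    · exact absurd rfl hne
  have hw0 : w ≠ 0 := by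
    obtain ⟨α, hα, hαN⟩ := hN'
    intro h0
    have hc : w.coeff (ν * α 0 + μ * α 1) = P.coeff α := by
      rw [hw, finsetSum_coeff, Finset.sum_eq_single α]
      · rw [coeff_monomial, if_pos rfl]
      · intro β hβ hβα
        rw [coeff_monomial, if_neg]
        intro heq
        obtain ⟨h1, h2⟩ := hline (β 0) (β 1) _ (Finset.mem_filter.mp hβ).2 heq
        obtain ⟨h3, h4⟩ := hline (α 0) (α 1) _ hαN rfl
        refine hβα (Finsupp.ext fun l => ?_)
        fin_cases l
        · change β 0 = α 0
          omega
        · change β 1 = α 1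
          omega
      · intro hn
        exact absurd (Finset.mem_filter.mpr ⟨hα, hαN⟩) hn
    rw [h0, coeff_zero] at hc
    exact MvPolynomial.mem_support_iff.mp hα hc.symm
  obtain ⟨w₁, hw₁⟩ : X ^ w.natTrailingDegree ∣ w :=
    X_pow_dvd_iff.mpr fun d hd => coeff_eq_zero_of_lt_natTrailingDegree hd
  set e := w.natTrailingDegree with he
  have hw₁0 : w₁ ≠ 0 := by
    rintro rfl
    exact hw0 (by rw [hw₁, mul_zero])
  have hdeg : w.natDegree = e + w₁.natDegree := by
    conv_lhs => rw [hw₁, natDegree_mul (pow_ne_zero _ X_ne_zero) hw₁0, natDegree_X_pow]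
  have hbound : a * b * w₁.natDegree ≤ N := by
    obtain ⟨i, j, h1, h2⟩ := hwcoeff e (by
      rw [he, ← trailingCoeff]
      exact mt trailingCoeff_eq_zero.mp hw0)
    obtain ⟨i', j', h3, h4⟩ := hwcoeff w.natDegree (by
      rw [coeff_natDegree]
      exact leadingCoeff_ne_zero.mpr hw0)
    have h5 := (hline i j e h1 h2).1
    have h6 := (hline i' j' _ h3 h4).2
    rw [hdeg] at h6
    push_cast at h6
    have h' : (ν * b : ℤ) = a * μ + 1 := by exact_mod_cast h
    have hb : (0 : ℤ) ≤ b * j' := by positivity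
    have ha : (0 : ℤ) ≤ a * i := by positivity
    zify
    have key : (a * b * w₁.natDegree : ℤ) = N - b * j' - a * i := by
      linear_combination (b : ℤ) * h6 - (a : ℤ) * h5 + (N : ℤ) * h'
    omega
  set v := w₁.comp (X + C 1) with hv
  have hv0 : v ≠ 0 := fun h0 => hw₁0 (comp_X_add_C_eq_zero_iff.mp h0)
  have hvdeg : v.natDegree = w₁.natDegree := by
    rw [hv, natDegree_comp, natDegree_X_add_C, mul_one]
  have hX1 : ((X + C 1 : k[X]) ^ e) ≠ 0 := pow_ne_zero _ (X_add_C_ne_zero 1)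
  have htrail : ((X + C 1 : k[X]) ^ e).natTrailingDegree = 0 := by
    refine Nat.le_zero.mp (natTrailingDegree_le_of_ne_zero ?_)
    rw [coeff_zero_eq_eval_zero]
    simp
  refine ⟨v.natTrailingDegree, le_trans (Nat.mul_le_mul_left _
    (hvdeg ▸ natTrailingDegree_le_natDegree v)) hbound,
    homPart_ne_zero_iff.mpr ⟨v.natTrailingDegree, 0, rfl, ?_⟩⟩
  have hcomp : (atInfinity a b μ ν N P).coeff 0 = (X + C 1) ^ e * v := by
    conv_lhs => rw [hcoeff, hw₁, mul_comp, pow_comp, X_comp]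
  have ht : v.natTrailingDegree = ((X + C 1) ^ e * v).natTrailingDegree := by
    rw [natTrailingDegree_mul hX1 hv0, htrail, zero_add]
  rw [hcomp, ht, ← trailingCoeff]
  exact mt trailingCoeff_eq_zero.mp (mul_ne_zero hX1 hv0)

end WeightedLeadingForm

/-- The numerical contradiction between the multiplicity `m` of a polynomial at a point at infinity
and its order of vanishing `N g` along a valuation: these imply `a b < 1 + a + b`, which leaves only
`a = b = 2` when `a, b ≥ 2`. -/
theorem weights_contradiction {a b g m N : ℕ} (hcop : Nat.Coprime a b) (ha : 2 ≤ a) (hb : 2 ≤ b)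
    (hg : 0 < g) (hN : N ≠ 0) (hmN : a * b * m ≤ N)
    (hbound : (m : ℤ) * (-(g + g * a + g * b) + 1) ≤ N * -g) : False := by
  have h1 : N * g + m ≤ m * (g + g * a + g * b) := by
    zify
    linarith
  have hm : 0 < m := by
    rcases Nat.eq_zero_or_pos m with rfl | hm
    · have := Nat.mul_pos (Nat.pos_of_ne_zero hN) hg
      omega
    · exact hm
  have h2 : m * (a * b * g) + m ≤ m * (g + g * a + g * b) := by
    calc m * (a * b * g) + m = a * b * m * g + m := by ring
      _ ≤ N * g + m := by gcongr
      _ ≤ _ := h1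
  have h3 : a * b * g + 1 ≤ g + g * a + g * b := by
    refine Nat.le_of_mul_le_mul_left ?_ hm
    rwa [mul_add, mul_one]
  have h4 : a * b < 1 + a + b := by
    refine Nat.lt_of_mul_lt_mul_left (a := g) ?_
    calc g * (a * b) = a * b * g := by ring
      _ < g + g * a + g * b := h3
      _ = g * (1 + a + b) := by ring
  obtain ⟨c, rfl⟩ := Nat.exists_eq_add_of_le ha
  obtain ⟨d, rfl⟩ := Nat.exists_eq_add_of_le hb
  have h5 : c + d + c * d < 1 := by
    ring_nf at h4 ⊢
    omega
  obtain rfl : c = 0 := by omega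
  obtain rfl : d = 0 := by omega
  exact absurd hcop (by decide)

/-- If `x` and `y` generate `k[s, t]` and are monic in `t`, then one of their degrees in `t` divides
the other one. Otherwise `blowup_bound` applies to the polynomial expressing `s` in terms of `x` and
`y`, in the local coordinates `τ` and `z - 1` at a point at infinity of a weighted projective plane:
`τ` has degree `-g` in `t`, and `z` has the value `1`. -/
theorem natDegree_dvd_of_generators {k : Type*} [Field k] {x y : k[X][X]}
    {P Q : MvPolynomial (Fin 2) k} (hP : MvPolynomial.aeval ![x, y] P = C X)
    (hQ : MvPolynomial.aeval ![x, y] Q = X) (hx : x.Monic) (hy : y.Monic)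
    (hx1 : 0 < x.natDegree) (hy1 : 0 < y.natDegree) :
    x.natDegree ∣ y.natDegree ∨ y.natDegree ∣ x.natDegree := by
  set g := x.natDegree.gcd y.natDegree with hg
  have hg0 : 0 < g := Nat.gcd_pos_of_pos_left _ hx1
  obtain ⟨a, ha⟩ : g ∣ x.natDegree := Nat.gcd_dvd_left _ _
  obtain ⟨b, hb⟩ : g ∣ y.natDegree := Nat.gcd_dvd_right _ _
  have hcop : Nat.Coprime a b := by
    have := hg
    rw [ha, hb, Nat.gcd_mul_left] at this
    exact Nat.eq_of_mul_eq_mul_left hg0 (by rw [mul_one]; exact this.symm)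
  by_contra! hndvd
  have ha2 : 2 ≤ a := by
    by_contra! hlt
    interval_cases a
    · omega
    · exact hndvd.1 (by rw [ha, hb, mul_one]; exact dvd_mul_right _ _)
  have hb2 : 2 ≤ b := by
    by_contra! hlt
    interval_cases b
    · omega
    · exact hndvd.2 (by rw [ha, hb, mul_one]; exact dvd_mul_right _ _)
  obtain ⟨ν, hν⟩ := Nat.exists_mul_mod_eq_one_of_coprime hcop.symm (by omega : 1 < a)
  set μ := b * ν / a with hμ
  have hdet : ν * b = a * μ + 1 := by
    rw [mul_comm, ← Nat.div_add_mod (b * ν) a, hν.2]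
  set x' := toField k x with hx'
  set y' := toField k y with hy'
  have hx0 : x' ≠ 0 := fun h => hx.ne_zero (toField_injective (by rw [← hx', h, map_zero]))
  have hy0 : y' ≠ 0 := fun h => hy.ne_zero (toField_injective (by rw [← hy', h, map_zero]))
  have hxdeg : x'.intDegree = g * a := by
    rw [hx', intDegree_toField, ha]
    push_cast
    ring
  have hydeg : y'.intDegree = g * b := by
    rw [hy', intDegree_toField, hb]
    push_cast
    ring
  set τ := x' ^ μ / y' ^ ν with hτ
  set z := x' ^ b / y' ^ a with hz
  have hτ0 : τ ≠ 0 := div_ne_zero (pow_ne_zero _ hx0) (pow_ne_zero _ hy0)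
  have hz0 : z ≠ 0 := div_ne_zero (pow_ne_zero _ hx0) (pow_ne_zero _ hy0)
  have hdet' : (ν * b : ℤ) = a * μ + 1 := by exact_mod_cast hdet
  have hτdeg : τ.intDegree = -g := by
    rw [hτ, RatFunc.intDegree_div (pow_ne_zero _ hx0) (pow_ne_zero _ hy0), intDegree_pow hx0,
      intDegree_pow hy0, hxdeg, hydeg]
    linear_combination -(g : ℤ) * hdet'
  have hzdeg : z.intDegree = 0 := by
    rw [hz, RatFunc.intDegree_div (pow_ne_zero _ hx0) (pow_ne_zero _ hy0), intDegree_pow hx0,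
      intDegree_pow hy0, hxdeg, hydeg]
    ring
  have hτmem : τ ∈ degLE (RatFunc k) (-1) := by
    rw [mem_degLE_of_ne hτ0]
    omega
  -- Both `x ^ b` and `y ^ a` are monic of degree `g a b`, so `z` has the value `1` at infinity.
  have humem : z - 1 ∈ degLE (RatFunc k) (-1) := by
    have hxb : (x ^ b).natDegree = g * a * b := by rw [hx.natDegree_pow, ha]; ring
    have hya : (y ^ a).natDegree = g * a * b := by rw [hy.natDegree_pow, hb]; ring
    have hpos : 0 < g * a * b := by positivity
    have h1 : z - 1 = toField k (x ^ b - y ^ a) * (toField k (y ^ a))⁻¹ := by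
      have : toField k (y ^ a) ≠ 0 := by
        rw [map_pow]
        exact pow_ne_zero _ hy0
      rw [hz, map_sub, sub_mul, mul_inv_cancel₀ this, map_pow, map_pow, div_eq_mul_inv]
    have h2 : toField k (x ^ b - y ^ a) ∈ degLE (RatFunc k) ((g * a * b : ℕ) - 1) := by
      by_cases h0 : x ^ b - y ^ a = 0
      · rw [h0, map_zero]
        exact zero_mem _
      · have hlt : (x ^ b - y ^ a).natDegree < g * a * b := by
          have := degree_sub_lt_left (p := x ^ b) (q := y ^ a)
            (by rw [degree_eq_natDegree (hx.pow b).ne_zero, degree_eq_natDegree (hy.pow a).ne_zero,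
              hxb, hya]) (hx.pow b).ne_zero
            (by rw [(hx.pow b).leadingCoeff, (hy.pow a).leadingCoeff])
          rw [← hxb]
          exact natDegree_lt_natDegree h0 this
        refine Or.inr ?_
        rw [intDegree_toField]
        omega
    have h3 : (toField k (y ^ a))⁻¹ ∈ degLE (RatFunc k) (-(g * a * b : ℕ)) := inv_mem_degLE (by
      rw [intDegree_toField, hya]
      omega)
    rw [h1]
    exact degLE_mono (by omega) (mul_mem_degLE h2 h3)
  obtain ⟨hj0, hjdeg⟩ := jac_of_generators hP hQ
  have hJ := jac_monomials (derivS k) (derivT k) hx0 hy0 hdet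
  rw [← hτ, ← hz] at hJ
  have hJu : jac (derivS k) (derivT k) τ (z - 1) = jac (derivS k) (derivT k) τ z := by
    simp [jac]
  have hJ0 : jac (derivS k) (derivT k) τ z ≠ 0 := by
    intro h0
    rw [h0, zero_mul] at hJ
    exact mul_ne_zero (mul_ne_zero hτ0 hz0) hj0 hJ.symm
  have hJdeg : (jac (derivS k) (derivT k) τ z).intDegree = -(g + g * a + g * b) := by
    have := congrArg RatFunc.intDegree hJ
    rw [RatFunc.intDegree_mul hJ0 (mul_ne_zero hx0 hy0), RatFunc.intDegree_mul hx0 hy0,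
      RatFunc.intDegree_mul (mul_ne_zero hτ0 hz0) hj0, RatFunc.intDegree_mul hτ0 hz0, hxdeg, hydeg,
      hτdeg, hzdeg, hjdeg] at this
    omega
  have hP0 : P ≠ 0 := by
    rintro rfl
    rw [map_zero] at hP
    exact X_ne_zero (C_injective (hP.symm.trans C_0.symm))
  have hsupp : P.support.Nonempty := MvPolynomial.support_nonempty.mpr hP0
  set wt : (Fin 2 →₀ ℕ) → ℕ := fun α => a * α 0 + b * α 1 with hwt
  obtain ⟨β, hβ, hβmax⟩ := P.support.exists_max_image wt hsupp
  set N := wt β with hN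
  obtain ⟨m, hmN, hm⟩ := exists_homPart_atInfinity hdet (N := N) (P := P)
    (fun α hα => hβmax α hα) ⟨β, hβ, rfl⟩
  have hxτ : x' * τ ^ a = z ^ ν := by
    rw [hτ, hz, div_pow, div_pow, ← pow_mul, ← pow_mul, ← pow_mul, ← pow_mul, mul_comm ν a,
      mul_comm b ν, hdet, mul_comm μ a, pow_succ]
    ring
  have hyτ : y' * τ ^ b = z ^ μ := by
    rw [hτ, hz, div_pow, div_pow, ← pow_mul, ← pow_mul, ← pow_mul, ← pow_mul, hdet, mul_comm μ b,
      pow_succ]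
    field_simp
  have hev : aevalAeval (z - 1) τ (atInfinity a b μ ν N P) = τ ^ N * toField k (C X) := by
    rw [aevalAeval_atInfinity (fun α hα => hβmax α hα) hxτ hyτ, ← hP]
    congr 1
    have : MvPolynomial.aeval ![x', y'] = (toField k).comp (MvPolynomial.aeval ![x, y]) := by
      ext i
      fin_cases i <;> simp [hx', hy']
    exact DFunLike.congr_fun this P
  have hbound := (blowup_bound (derivS k) (derivT k) (fun c hc => RatFunc.transcendental_of_ne_C c
    (fun ⟨d, hd⟩ => hc ⟨d, hd ▸ rfl⟩)) derivS_mem_degLE derivT_mem_degLE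
    (g + g * a + g * b) _ m τ (z - 1) hτmem humem (by rwa [hJu]) (by
      rw [hJu, hJdeg]
      push_cast
      omega) hm).2
  have hs0 : toField k (C X) ≠ 0 := fun h => by
    have := toField_injective (h.trans (map_zero _).symm)
    simp at this
  rw [hJu, hJdeg, hev, RatFunc.intDegree_mul (pow_ne_zero _ hτ0) hs0, intDegree_pow hτ0, hτdeg,
    intDegree_toField, natDegree_C, Nat.cast_zero, add_zero] at hbound
  -- The weighted degree `N` is positive, since `P` is not constant.
  have hN0 : N ≠ 0 := by
    intro h0
    have hsupp0 : ∀ α ∈ P.support, α = 0 := by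
      intro α hα
      have h1 : a * α 0 + b * α 1 ≤ 0 := h0 ▸ hβmax α hα
      have h2 : a * α 0 = 0 := by omega
      have h3 : b * α 1 = 0 := by omega
      ext l
      fin_cases l
      · exact (Nat.mul_eq_zero.mp h2).resolve_left (by omega)
      · exact (Nat.mul_eq_zero.mp h3).resolve_left (by omega)
    have hPC : P = MvPolynomial.C (P.coeff 0) := by
      ext α
      rw [MvPolynomial.coeff_C]
      split_ifs with h
      · rw [h]
      · by_contra hne
        exact h (hsupp0 α (MvPolynomial.mem_support_iff.mpr hne)).symm
    rw [hPC, MvPolynomial.aeval_C] at hP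
    have := C_injective (hP : C (C (P.coeff 0)) = C X)
    exact X_ne_C _ this.symm
  exact weights_contradiction hcop ha2 hb2 hg0 hN0 hmN hbound

/-! ### Pairs of generators and division with remainder -/

section Generators

variable {k : Type*} [Field k]

/-- The polynomials `x` and `y` generate the algebra `k[s, t]`. -/
def Generates (x y : k[X][X]) : Prop := Algebra.adjoin k {x, y} = ⊤

theorem Generates.symm {x y : k[X][X]} (h : Generates x y) : Generates y x := by
  rw [Generates, Set.pair_comm]
  exact h

theorem generates_iff {x y : k[X][X]} :
    Generates x y ↔ ∀ r, ∃ P : MvPolynomial (Fin 2) k, MvPolynomial.aeval ![x, y] P = r := by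
  have : ({x, y} : Set k[X][X]) = Set.range ![x, y] := by
    simp [Matrix.range_cons, Set.pair_comm]
  rw [Generates, this, Algebra.adjoin_range_eq_range_aeval, AlgHom.range_eq_top]
  rfl

theorem Generates.shear {x y : k[X][X]} (h : Generates x y) (f : k[X]) :
    Generates (x + aeval y f) y := by
  refine top_le_iff.mp (h.ge.trans (Algebra.adjoin_le ?_))
  have hy : y ∈ Algebra.adjoin k {x + aeval y f, y} := Algebra.subset_adjoin (by simp)
  have hx : x + aeval y f ∈ Algebra.adjoin k {x + aeval y f, y} :=
    Algebra.subset_adjoin (by simp)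
  have hf : aeval y f ∈ Algebra.adjoin k {x + aeval y f, y} :=
    Algebra.adjoin_mono (by simp) (aeval_mem_adjoin_singleton k y)
  rintro _ (rfl | rfl)
  · simpa using sub_mem hx hf
  · exact hy

theorem algHom_ext₂ {A : Type*} [CommRing A] [Algebra k A] {f g : k[X][X] →ₐ[k] A}
    (hs : f (C X) = g (C X)) (ht : f X = g X) : f = g :=
  (aevalAevalEquiv k A).symm.injective (Prod.ext hs ht)

theorem aevalAeval_eq_eval₂ {A : Type*} [CommRing A] [Algebra k A] (a b : A) (p : k[X][X]) :
    aevalAeval a b p = eval₂ (aeval a : k[X] →ₐ[k] A).toRingHom b p := by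
  induction p using Polynomial.induction_on' with
  | add p q hp hq => rw [map_add, eval₂_add, hp, hq]
  | monomial n q =>
    rw [eval₂_monomial, ← C_mul_X_pow_eq_monomial, map_mul, map_pow, aevalAeval_C, aevalAeval_Y]
    rfl

/-- The coordinate ring of the curve `x = 0` is the polynomial ring `k[y]`, in which `s` and `t`
become the restrictions `P(0, y)` and `Q(0, y)` of their expressions in terms of `x` and `y`. -/
theorem dvd_of_restriction_eq_zero {x y : k[X][X]} {P Q : MvPolynomial (Fin 2) k}
    (hP : MvPolynomial.aeval ![x, y] P = C X) (hQ : MvPolynomial.aeval ![x, y] Q = X)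
    {r : k[X][X]} (hr : aevalAeval (MvPolynomial.aeval ![0, X] P)
      (MvPolynomial.aeval ![0, (X : k[X])] Q) r = 0) : x ∣ r := by
  set R := aevalAeval P Q r with hR
  have h1 : MvPolynomial.aeval ![x, y] R = r := by
    have : (MvPolynomial.aeval ![x, y]).comp (aevalAeval P Q) = AlgHom.id k k[X][X] := by
      refine algHom_ext₂ ?_ ?_
      · rw [AlgHom.comp_apply, aevalAeval_X, hP, AlgHom.id_apply]
      · rw [AlgHom.comp_apply, aevalAeval_Y, hQ, AlgHom.id_apply]
    exact DFunLike.congr_fun this r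
  have h2 : MvPolynomial.aeval ![0, (X : k[X])] R = 0 := by
    have : (MvPolynomial.aeval ![0, (X : k[X])]).comp (aevalAeval P Q) =
        aevalAeval (MvPolynomial.aeval ![0, X] P) (MvPolynomial.aeval ![0, (X : k[X])] Q) := by
      refine algHom_ext₂ ?_ ?_
      · rw [AlgHom.comp_apply, aevalAeval_X, aevalAeval_X]
      · rw [AlgHom.comp_apply, aevalAeval_Y, aevalAeval_Y]
    exact (DFunLike.congr_fun this r).trans hr
  have h3 : MvPolynomial.aeval ![0, y] R = 0 := by
    have : (aeval y).comp (MvPolynomial.aeval ![0, (X : k[X])]) =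
        (MvPolynomial.aeval ![0, y] : MvPolynomial (Fin 2) k →ₐ[k] k[X][X]) := by
      ext i
      fin_cases i <;> simp
    rw [← this, AlgHom.comp_apply, h2, map_zero]
  rw [← Ideal.mem_span_singleton, ← Ideal.Quotient.eq_zero_iff_mem, ← h1]
  set π := Ideal.Quotient.mkₐ k (Ideal.span {x}) with hπ
  have hx : π x = 0 := Ideal.Quotient.eq_zero_iff_mem.mpr (Ideal.mem_span_singleton_self x)
  have h4 : π.comp (MvPolynomial.aeval ![x, y]) = π.comp (MvPolynomial.aeval ![0, y]) := by
    ext i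
    fin_cases i <;> simp [hx]
  have h5 := DFunLike.congr_fun h4 R
  rw [AlgHom.comp_apply, AlgHom.comp_apply, h3, map_zero] at h5
  exact h5

/-- A nonconstant polynomial `p` makes `k[X]` integral over `k[p]`. -/
theorem isIntegralElem_of_natDegree_pos {p : k[X]} (hp : 0 < p.natDegree) (q : k[X]) :
    (aeval p : k[X] →ₐ[k] k[X]).toRingHom.IsIntegralElem q := by
  set φ := (aeval p : k[X] →ₐ[k] k[X]).toRingHom with hφ
  have hφC : ∀ c, φ (C c) = C c := fun c => by
    change aeval p (C c) = _
    rw [aeval_C]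
    rfl
  have hX : φ.IsIntegralElem X := by
    have hp0 : p ≠ 0 := by
      rintro rfl
      simp at hp
    have hmap : (p.map (C : k →+* k[X])).natDegree = p.natDegree :=
      natDegree_map_eq_of_injective C_injective p
    have hdeg : (p.map (C : k →+* k[X]) - C X).natDegree = p.natDegree := by
      rw [natDegree_sub_C, hmap]
    refine ⟨C (C p.leadingCoeff⁻¹) * (p.map C - C X), ?_, ?_⟩
    · have hlc : (p.map (C : k →+* k[X]) - C X).leadingCoeff = C p.leadingCoeff := by
        rw [leadingCoeff, hdeg, coeff_sub, coeff_C, if_neg hp.ne', sub_zero, coeff_map,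
          coeff_natDegree]
      rw [Monic, leadingCoeff_mul, leadingCoeff_C, hlc, ← C_mul,
        inv_mul_cancel₀ (leadingCoeff_ne_zero.mpr hp0), C_1]
    · have h1 : eval₂ φ X (p.map (C : k →+* k[X])) = p := by
        rw [eval₂_map]
        have : φ.comp C = C := RingHom.ext hφC
        rw [this, eval₂_C_X]
      have h2 : φ X = p := aeval_X p
      rw [eval₂_mul, eval₂_sub, h1, eval₂_C, eval₂_C, h2, sub_self, mul_zero]
  induction q using Polynomial.induction_on' with
  | add p q hp hq => exact hp.add φ hq
  | monomial n a =>
    rw [← C_mul_X_pow_eq_monomial]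
    refine RingHom.IsIntegralElem.mul φ ?_ ?_
    · rw [← hφC]
      exact φ.isIntegralElem_map
    · induction n with
      | zero =>
        rw [pow_zero, ← map_one φ]
        exact φ.isIntegralElem_map
      | succ n ih =>
        rw [pow_succ]
        exact ih.mul φ hX

theorem Generates.ne_C {x y : k[X][X]} (h : Generates x y) (c : k) : x ≠ C (C c) := by
  rintro rfl
  obtain ⟨P, hP⟩ := generates_iff.mp h (C X)
  obtain ⟨Q, hQ⟩ := generates_iff.mp h X
  apply (jac_of_generators hP hQ).1
  have : toField k (C (C c)) = algebraMap k _ c := (toField k).commutes c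
  simp [jac, this]

/-- A member `x` of a pair of generators of `k[s, t]` is a linear polynomial in `s`, or its leading
coefficient in `t` is a unit. If `s` is constant on the curve `x = 0`, the curve is a line
`s = c`. Otherwise `t` is integral over `k[s]` on the curve, so `x` divides a polynomial that is
monic in `t`. -/
theorem Generates.leadingCoeff_cases {x y : k[X][X]} (h : Generates x y) :
    (∃ α c : k, α ≠ 0 ∧ x = C (C α * (X - C c))) ∨
      (0 < x.natDegree ∧ IsUnit x.leadingCoeff) := by
  obtain ⟨P, hP⟩ := generates_iff.mp h (C X)
  obtain ⟨Q, hQ⟩ := generates_iff.mp h X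
  have hunit : ∀ u : k[X], IsUnit u → x ≠ C u := by
    rintro u hu rfl
    obtain ⟨c, -, rfl⟩ := Polynomial.isUnit_iff.mp hu
    exact h.ne_C c rfl
  rcases Nat.eq_zero_or_pos (MvPolynomial.aeval ![0, (X : k[X])] P).natDegree with h0 | hpos
  · left
    rw [natDegree_eq_zero] at h0
    obtain ⟨c, hc⟩ := h0
    have hdvd : x ∣ C (X - C c) := by
      refine dvd_of_restriction_eq_zero hP hQ ?_
      rw [aevalAeval_C, map_sub, aeval_X, aeval_C, ← hc]
      exact sub_self _
    have hX : (X - C c : k[X]) ≠ 0 := X_sub_C_ne_zero c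
    have hx0 : x.natDegree = 0 := by
      have := natDegree_le_of_dvd hdvd (by rwa [Ne, C_eq_zero])
      simpa using this
    obtain ⟨x₀, rfl⟩ := natDegree_eq_zero.mp hx0
    have hdvd' : x₀ ∣ X - C c := (C_dvd_iff_dvd_coeff _ _).mp hdvd 0 |>.trans (by simp)
    have hassoc := ((irreducible_X_sub_C c).dvd_iff.mp hdvd').resolve_left
      (fun hu => hunit x₀ hu rfl)
    obtain ⟨u, hu⟩ := hassoc
    obtain ⟨α, hα, hαu⟩ := Polynomial.isUnit_iff.mp u.isUnit
    refine ⟨α, c, hα.ne_zero, ?_⟩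
    rw [← hu, ← hαu, mul_comm]
  · right
    obtain ⟨M, hM, hM0⟩ := isIntegralElem_of_natDegree_pos hpos
      (MvPolynomial.aeval ![0, (X : k[X])] Q)
    obtain ⟨w, hw⟩ : x ∣ M := by
      refine dvd_of_restriction_eq_zero hP hQ ?_
      rw [aevalAeval_eq_eval₂, hM0]
    have hlc : IsUnit x.leadingCoeff := by
      refine IsUnit.of_mul_eq_one w.leadingCoeff ?_
      rw [← leadingCoeff_mul, ← hw, hM]
    refine ⟨Nat.pos_of_ne_zero fun h0 => ?_, hlc⟩
    obtain ⟨x₀, rfl⟩ := natDegree_eq_zero.mp h0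
    rw [leadingCoeff_C] at hlc
    exact hunit x₀ hlc rfl

/-- If an element `u` of `k[s]` and `y` generate `k[s, t]`, then `y` has degree `1` in `t`, because
`t` is a polynomial in `y` over `k[s]`. -/
theorem Generates.natDegree_eq_one {u : k[X]} {y : k[X][X]} (h : Generates (C u) y) :
    y.natDegree = 1 := by
  have hle : Algebra.adjoin k {C u, y} ≤
      ((aeval y : k[X][X] →ₐ[k[X]] k[X][X]).range).restrictScalars k := by
    refine Algebra.adjoin_le ?_
    rintro _ (rfl | rfl)
    · exact ⟨C u, by simp⟩
    · exact ⟨X, by simp⟩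
  obtain ⟨q, hq⟩ := hle (h.ge (Algebra.mem_top : (X : k[X][X]) ∈ ⊤))
  have hq' : q.comp y = X := hq
  have := congrArg natDegree hq'
  rw [natDegree_comp, natDegree_X] at this
  exact Nat.eq_one_of_mul_eq_one_left this

theorem ZMod2_cases (c : ZMod 2) : c = 0 ∨ c = 1 := by
  revert c
  decide

/-- Over `𝔽₂`, a member of a pair of generators of `k[s, t]` is `s + c` or monic in `t`. -/
theorem Generates.cases {x y : (ZMod 2)[X][X]} (h : Generates x y) :
    (∃ c, x = C (X + C c)) ∨ (0 < x.natDegree ∧ x.Monic) := by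
  rcases h.leadingCoeff_cases with ⟨α, c, hα, rfl⟩ | ⟨hpos, hu⟩
  · left
    refine ⟨-c, ?_⟩
    rw [(ZMod2_cases α).resolve_left hα, C_1, one_mul, C_neg, sub_eq_add_neg]
  · right
    refine ⟨hpos, ?_⟩
    obtain ⟨c, hc, hcu⟩ := Polynomial.isUnit_iff.mp hu
    rw [Monic, ← hcu, (ZMod2_cases c).resolve_left hc.ne_zero, C_1]

/-- If `deg_t u = 0`, a pair of generators `y, u` over `𝔽₂` is of the form `t + f(s), s + c`. -/
theorem Generates.cases_right {y : (ZMod 2)[X][X]} {u : (ZMod 2)[X]} (h : Generates y (C u)) :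
    ∃ f c, u = X + C c ∧ y = X + C f := by
  have hdeg := h.symm.natDegree_eq_one
  have hy : y.Monic := by
    rcases h.cases with ⟨c, rfl⟩ | h
    · simp at hdeg
    · exact h.2
  rcases h.symm.cases with ⟨c, hc⟩ | h
  · refine ⟨y.coeff 0, c, C_injective hc, ?_⟩
    conv_lhs => rw [eq_X_add_C_of_natDegree_le_one hdeg.le]
    have : y.coeff 1 = 1 := by
      rw [← hdeg]
      exact hy
    rw [this, C_1, one_mul]
  · simp at h

theorem Generates.dvd {x y : (ZMod 2)[X][X]} (h : Generates x y) (hx : 0 < x.natDegree)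
    (hy : 0 < y.natDegree) : x.natDegree ∣ y.natDegree ∨ y.natDegree ∣ x.natDegree := by
  obtain ⟨P, hP⟩ := generates_iff.mp h (C X)
  obtain ⟨Q, hQ⟩ := generates_iff.mp h X
  refine natDegree_dvd_of_generators hP hQ ?_ ?_ hx hy
  · rcases h.cases with ⟨c, rfl⟩ | h
    · simp at hx
    · exact h.2
  · rcases h.symm.cases with ⟨c, rfl⟩ | h
    · simp at hy
    · exact h.2

theorem Generates.monic {x y : (ZMod 2)[X][X]} (h : Generates x y) (hx : 0 < x.natDegree) :
    x.Monic := by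
  rcases h.cases with ⟨c, rfl⟩ | h
  · simp at hx
  · exact h.2

/-- If `deg y ≤ deg x` and `deg y ≠ 0`, then the degree of `x` is lowered by subtracting a power
of `y`. -/
theorem Generates.exists_reduction {x y : (ZMod 2)[X][X]} (h : Generates x y)
    (hy : 0 < y.natDegree) (hle : y.natDegree ≤ x.natDegree) :
    ∃ r, (x - y ^ r).natDegree < x.natDegree := by
  have hx := hy.trans_le hle
  obtain ⟨r, hr⟩ : y.natDegree ∣ x.natDegree := by
    rcases h.dvd hx hy with h1 | h1
    · rw [le_antisymm hle (Nat.le_of_dvd hy h1)]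
    · exact h1
  have hxm := h.monic hx
  have hym := h.symm.monic hy
  have hdeg : (y ^ r).natDegree = x.natDegree := by
    rw [hym.natDegree_pow, hr, mul_comm]
  refine ⟨r, ?_⟩
  by_cases h0 : x - y ^ r = 0
  · rw [h0, natDegree_zero]
    exact hx
  · refine natDegree_lt_natDegree h0 (degree_sub_lt_left ?_ hxm.ne_zero ?_)
    · rw [degree_eq_natDegree hxm.ne_zero, degree_eq_natDegree (hym.pow r).ne_zero, hdeg]
    · rw [hxm.leadingCoeff, (hym.pow r).leadingCoeff]

/-- Division with remainder: `x = f(y) + x₀` with `deg x₀ < deg y`. -/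
theorem Generates.exists_division {x y : (ZMod 2)[X][X]} (h : Generates x y)
    (hy : 0 < y.natDegree) : ∃ f : (ZMod 2)[X], (x - aeval y f).natDegree < y.natDegree := by
  induction hn : x.natDegree using Nat.strong_induction_on generalizing x with
  | _ n ih =>
    by_cases hlt : x.natDegree < y.natDegree
    · exact ⟨0, by simpa using hlt⟩
    obtain ⟨r, hr⟩ := h.exists_reduction hy (not_lt.mp hlt)
    have h' : Generates (x - y ^ r) y := by
      have := h.shear (-X ^ r)
      rwa [map_neg, map_pow, aeval_X, ← sub_eq_add_neg] at this
    obtain ⟨f, hf⟩ := ih _ (hn ▸ hr) h' rfl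
    refine ⟨X ^ r + f, ?_⟩
    rwa [map_add, map_pow, aeval_X, ← sub_sub]

end Generators

/-! ### Plane automorphisms as pairs of generators -/

section Plane

variable {k : Type*} [Field k]

variable (k) in
/-- The identification of `k[X₀, X₁]` with `k[s, t]`. -/
noncomputable def planeEval : MvPolynomial (Fin 2) k →ₐ[k] k[X][X] :=
  MvPolynomial.aeval ![C X, X]

variable (k) in
/-- The inverse of `planeEval`. -/
noncomputable def planeLift : k[X][X] →ₐ[k] MvPolynomial (Fin 2) k :=
  aevalAeval (MvPolynomial.X 0) (MvPolynomial.X 1)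

theorem planeEval_X_zero : planeEval k (MvPolynomial.X 0) = C X := MvPolynomial.aeval_X _ _

theorem planeEval_X_one : planeEval k (MvPolynomial.X 1) = X := MvPolynomial.aeval_X _ _

theorem planeLift_C_X : planeLift k (C X) = MvPolynomial.X 0 := aevalAeval_X _ _

theorem planeLift_X : planeLift k X = MvPolynomial.X 1 := aevalAeval_Y _ _

theorem planeEval_planeLift (r : k[X][X]) : planeEval k (planeLift k r) = r := by
  have : (planeEval k).comp (planeLift k) = AlgHom.id k k[X][X] := by
    refine algHom_ext₂ ?_ ?_
    · rw [AlgHom.comp_apply, planeLift_C_X, planeEval_X_zero, AlgHom.id_apply]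
    · rw [AlgHom.comp_apply, planeLift_X, planeEval_X_one, AlgHom.id_apply]
  exact DFunLike.congr_fun this r

theorem planeEval_injective : Function.Injective (planeEval k) := by
  have : (planeLift k).comp (planeEval k) = AlgHom.id k _ := by
    refine MvPolynomial.algHom_ext fun i => ?_
    fin_cases i
    · exact (congrArg (planeLift k) planeEval_X_zero).trans planeLift_C_X
    · exact (congrArg (planeLift k) planeEval_X_one).trans planeLift_X
  exact Function.LeftInverse.injective (g := planeLift k) (DFunLike.congr_fun this)

/-- The `i`-th coordinate of an automorphism of the plane, as an element of `k[s, t]`. -/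
noncomputable def planeCoord (g : GA k 2) (i : Fin 2) : k[X][X] :=
  planeEval k (g.val.coord i)

theorem planeCoord_mul (h g : GA k 2) (i : Fin 2) :
    planeCoord (h * g) i =
      MvPolynomial.aeval ![planeCoord g 0, planeCoord g 1] (h.val.coord i) := by
  rw [planeCoord, mul_val_coord, planeEval, MvPolynomial.aeval_bind₁]
  congr 2
  funext j
  fin_cases j <;> rfl

theorem planeCoord_one : planeCoord (1 : GA k 2) 0 = C X ∧ planeCoord (1 : GA k 2) 1 = X :=
  ⟨planeEval_X_zero, planeEval_X_one⟩

theorem ext_planeCoord {g h : GA k 2} (h0 : planeCoord g 0 = planeCoord h 0)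
    (h1 : planeCoord g 1 = planeCoord h 1) : g = h := by
  refine ext_coord fun j => planeEval_injective ?_
  fin_cases j
  · exact h0
  · exact h1

theorem generates_planeCoord (g : GA k 2) : Generates (planeCoord g 0) (planeCoord g 1) := by
  rw [generates_iff]
  intro r
  have h : ∀ i, MvPolynomial.aeval ![planeCoord g 0, planeCoord g 1] ((g⁻¹).val.coord i) =
      planeEval k (MvPolynomial.X i) := fun i => by
    rw [← planeCoord_mul, inv_mul_cancel]
    rfl
  refine ⟨MvPolynomial.bind₁ (g⁻¹).val.coord (planeLift k r), ?_⟩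
  rw [MvPolynomial.aeval_bind₁]
  simp only [h]
  exact (DFunLike.congr_fun (MvPolynomial.aeval_unique (planeEval k)) _).symm.trans
    (planeEval_planeLift r)

variable (k) in
/-- The automorphism exchanging the two coordinates. -/
noncomputable def planeSwap : GA k 2 where
  val := ⟨![MvPolynomial.X 1, MvPolynomial.X 0]⟩
  inv := ⟨![MvPolynomial.X 1, MvPolynomial.X 0]⟩
  val_inv := PolyMap.ext (funext fun i => by
    fin_cases i <;> simp [PolyMap.mul_coord, PolyMap.one_coord])
  inv_val := PolyMap.ext (funext fun i => by
    fin_cases i <;> simp [PolyMap.mul_coord, PolyMap.one_coord])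

/-- The automorphism `(x, y) ↦ (x + f(y), y)`. -/
noncomputable def planeShear (f : k[X]) : GA k 2 where
  val := ⟨![MvPolynomial.X 0 + aeval (MvPolynomial.X 1) f, MvPolynomial.X 1]⟩
  inv := ⟨![MvPolynomial.X 0 - aeval (MvPolynomial.X 1) f, MvPolynomial.X 1]⟩
  val_inv := PolyMap.ext (funext fun i => by
    fin_cases i <;> simp [PolyMap.mul_coord, PolyMap.one_coord, ← aeval_algHom_apply])
  inv_val := PolyMap.ext (funext fun i => by
    fin_cases i <;> simp [PolyMap.mul_coord, PolyMap.one_coord, ← aeval_algHom_apply])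

theorem planeCoord_swap_mul (g : GA k 2) :
    planeCoord (planeSwap k * g) 0 = planeCoord g 1 ∧
      planeCoord (planeSwap k * g) 1 = planeCoord g 0 := by
  constructor <;> simp [planeCoord_mul, planeSwap]

theorem planeCoord_shear_mul (f : k[X]) (g : GA k 2) :
    planeCoord (planeShear f * g) 0 = planeCoord g 0 + aeval (planeCoord g 1) f ∧
      planeCoord (planeShear f * g) 1 = planeCoord g 1 := by
  constructor <;> simp [planeCoord_mul, planeShear, ← aeval_algHom_apply]

/-- The theorem of Jung and van der Kulk over `𝔽₂`: the automorphism group of the plane is generated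
by the exchange of the coordinates and the shears. The Euclidean algorithm lowers the sum of the
degrees in `t` of the two coordinates. -/
theorem mem_of_swap_of_shear {H : Subgroup (GA (ZMod 2) 2)} (hswap : planeSwap (ZMod 2) ∈ H)
    (hshear : ∀ f, planeShear f ∈ H) (g : GA (ZMod 2) 2) : g ∈ H := by
  have hsw : ∀ g, planeSwap (ZMod 2) * g ∈ H ↔ g ∈ H := fun g => H.mul_mem_cancel_left hswap
  have hsh : ∀ f g, planeShear f * g ∈ H ↔ g ∈ H := fun f g => H.mul_mem_cancel_left (hshear f)
  induction hn : (planeCoord g 0).natDegree + (planeCoord g 1).natDegree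
    using Nat.strong_induction_on generalizing g with
  | _ n ih =>
    wlog hle : (planeCoord g 1).natDegree ≤ (planeCoord g 0).natDegree generalizing g
    · rw [← hsw]
      obtain ⟨h0, h1⟩ := planeCoord_swap_mul g
      refine this _ ?_ ?_
      · rw [h0, h1, add_comm, hn]
      · rw [h0, h1]
        omega
    have hgen := generates_planeCoord g
    rcases Nat.eq_zero_or_pos (planeCoord g 1).natDegree with hy | hy
    · obtain ⟨u, hu⟩ := natDegree_eq_zero.mp hy
      rw [← hu] at hgen
      obtain ⟨f, c, rfl, hx⟩ := hgen.cases_right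
      -- Two shears and an exchange turn `(t + f(s), s + c)` into `(s, t)`.
      obtain ⟨h0, h1⟩ := planeCoord_shear_mul (-f.comp (X - C c)) g
      obtain ⟨h2, h3⟩ := planeCoord_swap_mul (planeShear (-f.comp (X - C c)) * g)
      obtain ⟨h4, h5⟩ := planeCoord_shear_mul (-C c)
        (planeSwap (ZMod 2) * (planeShear (-f.comp (X - C c)) * g))
      rw [← hsh (-f.comp (X - C c)), ← hsw, ← hsh (-C c)]
      have hf : aeval (C (X + C c)) (f.comp (X - C c)) = C f := by
        rw [aeval_comp, map_sub, aeval_X, aeval_C, C_add]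
        change aeval (C X + C (C c) - C (C c)) f = C f
        rw [add_sub_cancel_right]
        exact (aeval_algHom_apply (CAlgHom : (ZMod 2)[X] →ₐ[ZMod 2] (ZMod 2)[X][X]) X f).trans
          (congrArg C (aeval_X_left_apply f))
      convert H.one_mem
      refine ext_planeCoord ?_ ?_
      · rw [h4, h2, h3, h1, ← hu, planeCoord_one.1]
        simp
      · rw [h5, h3, h0, ← hu, hx, planeCoord_one.2, map_neg, hf]
        ring
    · obtain ⟨r, hr⟩ := hgen.exists_reduction hy hle
      rw [← hsh (-X ^ r)]
      obtain ⟨h0, h1⟩ := planeCoord_shear_mul (-X ^ r) g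
      refine ih _ ?_ _ rfl
      rw [h0, h1, map_neg, map_pow, aeval_X, ← sub_eq_add_neg]
      omega

end Plane

/-! ### An invariant of plane automorphisms over `𝔽₂` -/

section Invariant

/-- The functional `f ↦ f'(0) + f'(1)` on polynomials over `𝔽₂`. It is invariant under the
translation `X ↦ X + 1` and vanishes on polynomials of degree at most `1`, but not on `X ^ 3`. -/
noncomputable def shearWeight : (ZMod 2)[X] →+ ZMod 2 where
  toFun f := (derivative f).eval 0 + (derivative f).eval 1
  map_zero' := by simp
  map_add' f g := by
    simp only [derivative_add, eval_add]
    ring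

theorem shearWeight_apply (f : (ZMod 2)[X]) :
    shearWeight f = (derivative f).eval 0 + (derivative f).eval 1 := rfl

theorem shearWeight_C (c : ZMod 2) : shearWeight (C c) = 0 := by simp [shearWeight_apply]

theorem shearWeight_X : shearWeight X = 0 := by
  rw [shearWeight_apply, derivative_X, eval_one, eval_one]
  rfl

theorem shearWeight_X_pow_three : shearWeight (X ^ 3) = 1 := by
  simp only [shearWeight_apply, derivative_X_pow, eval_mul, eval_pow, eval_X, eval_C]
  decide

theorem shearWeight_comp (f : (ZMod 2)[X]) (c : ZMod 2) :
    shearWeight (f.comp (X + C c)) = shearWeight f := by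
  rw [shearWeight_apply, shearWeight_apply, derivative_comp, derivative_add, derivative_X,
    derivative_C, add_zero, one_mul, eval_comp, eval_comp]
  rcases ZMod2_cases c with rfl | rfl
  · simp
  · simp only [eval_add, eval_X, eval_C, zero_add]
    rw [show (1 : ZMod 2) + 1 = 0 from rfl, add_comm]

theorem shearWeight_of_natDegree_le_one {f : (ZMod 2)[X]} (hf : f.natDegree ≤ 1) :
    shearWeight f = 0 := by
  rw [eq_X_add_C_of_natDegree_le_one hf, map_add, shearWeight_C, add_zero]
  rcases ZMod2_cases (f.coeff 1) with h | h
  · rw [h, C_0, zero_mul, map_zero]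
  · rw [h, C_1, one_mul, shearWeight_X]

theorem natDegree_aeval {x : (ZMod 2)[X][X]} (f : (ZMod 2)[X]) :
    (aeval x f).natDegree = f.natDegree * x.natDegree := by
  have : aeval x f = (f.map (C : ZMod 2 →+* (ZMod 2)[X])).comp x := by
    rw [comp, eval₂_map]
    rfl
  rw [this, natDegree_comp, natDegree_map_eq_of_injective C_injective]

open Classical in
/-- The sum of the weights of the successive quotients in the Euclidean algorithm for `p` and `q`,
where a quotient is a polynomial `f` over `𝔽₂` with `deg (p - f(q)) < deg q`. The algorithm ends
with a pair `t + f(s), s + c`, which contributes the weight of `f`. The value `0` in the absence of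
a quotient plays no role for generators of `𝔽₂[s, t]`. -/
noncomputable def euclidWeight (p q : (ZMod 2)[X][X]) : ZMod 2 :=
  if q.natDegree = 0 then shearWeight (p.coeff 0)
  else if h : ∃ f : (ZMod 2)[X], (p - aeval q f).natDegree < q.natDegree then
    shearWeight h.choose + euclidWeight q (p - aeval q h.choose)
  else 0
termination_by q.natDegree
decreasing_by exact h.choose_spec

theorem euclidWeight_of_natDegree_eq_zero {p q : (ZMod 2)[X][X]} (h : q.natDegree = 0) :
    euclidWeight p q = shearWeight (p.coeff 0) := by
  rw [euclidWeight, if_pos h]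

theorem aeval_add_C {x : (ZMod 2)[X][X]} (f : (ZMod 2)[X]) (c : ZMod 2) :
    aeval x (f.comp (X + C c)) = aeval (x + C (C c)) f := by
  rw [aeval_comp, map_add, aeval_X, aeval_C]
  rfl

theorem exists_division_add_C {p q : (ZMod 2)[X][X]} (c d : ZMod 2)
    (h : ∃ f : (ZMod 2)[X], (p - aeval q f).natDegree < q.natDegree) :
    ∃ f : (ZMod 2)[X], (p + C (C c) - aeval (q + C (C d)) f).natDegree <
      (q + C (C d)).natDegree := by
  obtain ⟨f, hf⟩ := h
  refine ⟨f.comp (X + C (-d)) + C c, ?_⟩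
  have : p + C (C c) - aeval (q + C (C d)) (f.comp (X + C (-d)) + C c) = p - aeval q f := by
    rw [map_add, aeval_C, aeval_add_C, C_neg, C_neg, add_neg_cancel_right]
    change _ - (_ + C (C c)) = _
    ring
  rw [this, natDegree_add_C]
  exact hf

/-- The weight of a division with remainder does not depend on the choice of the quotient, and
the Euclidean algorithm is insensitive to adding constants. -/
theorem euclidWeight_aux (n : ℕ) : ∀ q : (ZMod 2)[X][X], q.natDegree = n →
    (∀ (p : (ZMod 2)[X][X]) (c d : ZMod 2),
      euclidWeight (p + C (C c)) (q + C (C d)) = euclidWeight p q) ∧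
    (q.natDegree ≠ 0 → ∀ (r : (ZMod 2)[X][X]) (f : (ZMod 2)[X]), r.natDegree < q.natDegree →
      euclidWeight (aeval q f + r) q = shearWeight f + euclidWeight q r) := by
  induction n using Nat.strong_induction_on with
  | _ n ih =>
    intro q hq
    have hdiv : ∀ q : (ZMod 2)[X][X], q.natDegree = n → n ≠ 0 →
        ∀ (r : (ZMod 2)[X][X]) (f : (ZMod 2)[X]),
        r.natDegree < q.natDegree →
        euclidWeight (aeval q f + r) q = shearWeight f + euclidWeight q r := by
      intro q hq hq0 r f hr
      have hex : ∃ f' : (ZMod 2)[X], (aeval q f + r - aeval q f').natDegree < q.natDegree :=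
        ⟨f, by rwa [add_sub_cancel_left]⟩
      rw [euclidWeight, if_neg (hq ▸ hq0), dif_pos hex]
      set f' := hex.choose
      have hf' := hex.choose_spec
      -- The two quotients differ by a constant, because `deg (f - f')(q) < deg q`.
      have hlt : (aeval q (f - f')).natDegree < q.natDegree := by
        have : aeval q (f - f') = (aeval q f + r - aeval q f') - r := by
          rw [map_sub]
          ring
        rw [this]
        exact (natDegree_sub_le _ _).trans_lt (max_lt hf' hr)
      rw [natDegree_aeval] at hlt
      have h0 : (f - f').natDegree = 0 := by
        by_contra hne
        exact absurd hlt (not_lt.mpr (Nat.le_mul_of_pos_left _ (Nat.pos_of_ne_zero hne)))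
      obtain ⟨c, hc⟩ := natDegree_eq_zero.mp h0
      have hf : f = f' + C c := by rw [hc, add_sub_cancel]
      have hrem : aeval q f + r - aeval q f' = r + C (C c) := by
        rw [hf, map_add, aeval_C]
        change _ + C (C c) + r - _ = _
        ring
      rw [hrem, hf, map_add, shearWeight_C, add_zero]
      have := (ih r.natDegree (hq ▸ hr) r rfl).1 q 0 c
      rw [C_0, C_0, add_zero] at this
      rw [this]
    refine ⟨fun p c d => ?_, fun h0 => hdiv q hq (hq ▸ h0)⟩
    have hqd : (q + C (C d)).natDegree = q.natDegree := natDegree_add_C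
    by_cases h0 : q.natDegree = 0
    · rw [euclidWeight_of_natDegree_eq_zero h0, euclidWeight_of_natDegree_eq_zero (hqd.trans h0),
        coeff_add, coeff_C_zero, map_add, shearWeight_C, add_zero]
    have hiff : (∃ f : (ZMod 2)[X], (p - aeval q f).natDegree < q.natDegree) ↔
        ∃ f : (ZMod 2)[X], (p + C (C c) - aeval (q + C (C d)) f).natDegree <
          (q + C (C d)).natDegree := by
      refine ⟨exists_division_add_C c d, fun h => ?_⟩
      have := exists_division_add_C (-c) (-d) h
      rwa [C_neg, C_neg, C_neg, C_neg, add_neg_cancel_right, add_neg_cancel_right] at this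
    by_cases hex : ∃ f : (ZMod 2)[X], (p - aeval q f).natDegree < q.natDegree
    · obtain ⟨f, hf⟩ := hex
      have hp : p = aeval q f + (p - aeval q f) := by ring
      set r := p - aeval q f
      have hp' : p + C (C c) =
          aeval (q + C (C d)) (f.comp (X + C (-d)) + C c) + r := by
        rw [map_add, aeval_C, aeval_add_C, C_neg, C_neg, add_neg_cancel_right]
        change _ = _ + C (C c) + r
        rw [hp]
        ring
      have hr := (ih r.natDegree (hq ▸ hf) r rfl).1 q d 0
      rw [C_0, C_0, add_zero] at hr
      rw [hp', hdiv _ (hqd.trans hq) (hq ▸ h0) _ _ (hqd.symm ▸ hf), map_add, shearWeight_comp,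
        shearWeight_C, add_zero, hr]
      conv_rhs => rw [hp]
      rw [hdiv q hq (hq ▸ h0) _ _ hf]
    · conv_rhs => rw [euclidWeight, if_neg h0, dif_neg hex]
      rw [euclidWeight, if_neg (hqd ▸ h0), dif_neg (mt hiff.mpr hex)]

theorem euclidWeight_add_C (p q : (ZMod 2)[X][X]) (c d : ZMod 2) :
    euclidWeight (p + C (C c)) (q + C (C d)) = euclidWeight p q :=
  (euclidWeight_aux _ q rfl).1 p c d

theorem euclidWeight_division {q r : (ZMod 2)[X][X]} (h : r.natDegree < q.natDegree)
    (f : (ZMod 2)[X]) : euclidWeight (aeval q f + r) q = shearWeight f + euclidWeight q r :=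
  (euclidWeight_aux _ q rfl).2 (by omega) r f h

theorem euclidWeight_add_aeval {p q : (ZMod 2)[X][X]} (h : Generates p q) (f : (ZMod 2)[X]) :
    euclidWeight (p + aeval q f) q = shearWeight f + euclidWeight p q := by
  rcases Nat.eq_zero_or_pos q.natDegree with h0 | hpos
  · obtain ⟨u, rfl⟩ := natDegree_eq_zero.mp h0
    obtain ⟨-, c, rfl, -⟩ := h.cases_right
    have : aeval (C (X + C c)) f = C (f.comp (X + C c)) :=
      aeval_algHom_apply (CAlgHom : (ZMod 2)[X] →ₐ[ZMod 2] (ZMod 2)[X][X]) (X + C c) f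
    rw [euclidWeight_of_natDegree_eq_zero h0, euclidWeight_of_natDegree_eq_zero h0, this,
      coeff_add, coeff_C_zero, map_add, shearWeight_comp, add_comm]
  · obtain ⟨f₀, hf₀⟩ := h.exists_division hpos
    have h1 : p = aeval q f₀ + (p - aeval q f₀) := by ring
    have h2 : p + aeval q f = aeval q (f + f₀) + (p - aeval q f₀) := by
      rw [map_add]
      ring
    rw [h2, euclidWeight_division hf₀, map_add, add_assoc, ← euclidWeight_division hf₀, ← h1]

/-- The invariant of a pair of generators. The Euclidean algorithm is applied to a member of highest
degree and the member of lowest degree among `x`, `y` and `x + y`, which makes the result symmetric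
in `x` and `y` also when their degrees are equal. -/
noncomputable def pairWeight (x y : (ZMod 2)[X][X]) : ZMod 2 :=
  if x.natDegree < y.natDegree then euclidWeight y x
  else if y.natDegree < x.natDegree then euclidWeight x y
  else euclidWeight x (x + y)

theorem add_self_plane (x : (ZMod 2)[X][X]) : x + x = 0 := CharTwo.add_self_eq_zero x

/-- Adding a polynomial in `y` to `x` increases the invariant by the weight of that polynomial. If
`x₀` is the remainder of `x` on division by `y`, it suffices to consider `x₀ + f(y)`. When
`deg f ≥ 2`, this has higher degree than `y`, and `f` is the first quotient. When `deg f ≤ 1`, it is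
`x₀` or `x₀ + y` up to a constant, and the weight of `f` is zero. -/
theorem pairWeight_shear {x y : (ZMod 2)[X][X]} (h : Generates x y) (f : (ZMod 2)[X]) :
    pairWeight (x + aeval y f) y = shearWeight f + pairWeight x y := by
  rcases Nat.eq_zero_or_pos y.natDegree with h0 | hpos
  · have hx : ∀ f, (x + aeval y f).natDegree = 1 := fun f => by
      obtain ⟨u, rfl⟩ := natDegree_eq_zero.mp h0
      exact (h.shear f).symm.natDegree_eq_one
    have hxf := hx f
    have hx0 := hx 0
    rw [map_zero, add_zero] at hx0
    rw [pairWeight, if_neg (by omega), if_pos (by omega), euclidWeight_add_aeval h, pairWeight,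
      if_neg (by omega), if_pos (by omega)]
  · obtain ⟨f₀, hf₀⟩ := h.exists_division hpos
    set x₀ := x - aeval y f₀ with hx₀
    have hmain : ∀ f, pairWeight (x₀ + aeval y f) y = shearWeight f + euclidWeight y x₀ := by
      intro f
      by_cases h2 : 2 ≤ f.natDegree
      · have hdeg : y.natDegree < (aeval y f).natDegree := by
          rw [natDegree_aeval]
          nlinarith
        have hdeg' : y.natDegree < (x₀ + aeval y f).natDegree := by
          rwa [natDegree_add_eq_right_of_natDegree_lt (hf₀.trans hdeg)]
        rw [pairWeight, if_neg (by omega), if_pos hdeg', add_comm x₀, euclidWeight_division hf₀]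
      · have hf1 : f.natDegree ≤ 1 := by omega
        rw [shearWeight_of_natDegree_le_one hf1, zero_add, eq_X_add_C_of_natDegree_le_one hf1]
        set c := f.coeff 0
        have hx₀c : (x₀ + C (C c)).natDegree = x₀.natDegree := natDegree_add_C
        rcases ZMod2_cases (f.coeff 1) with h1 | h1
        · have : x₀ + aeval y (C (f.coeff 1) * X + C c) = x₀ + C (C c) := by
            rw [h1, C_0, zero_mul, zero_add, aeval_C]
            rfl
          rw [this, pairWeight, if_pos (by omega)]
          have := euclidWeight_add_C y x₀ 0 c
          rwa [C_0, C_0, add_zero] at this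
        · have hx : x₀ + aeval y (C (f.coeff 1) * X + C c) = y + (x₀ + C (C c)) := by
            rw [h1, C_1, one_mul, map_add, aeval_X, aeval_C]
            change _ + (_ + C (C c)) = _
            ring
          have hdeg : (y + (x₀ + C (C c))).natDegree = y.natDegree :=
            natDegree_add_eq_left_of_natDegree_lt (by omega)
          have hsum : y + (x₀ + C (C c)) + y = x₀ + C (C c) := by
            linear_combination add_self_plane y
          rw [hx, pairWeight, if_neg (by omega), if_neg (by omega), hsum]
          have hgen : Generates y (x₀ + C (C c)) := by
            have := (h.shear (-f₀ + C c)).symm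
            rwa [map_add, map_neg, ← add_assoc, ← sub_eq_add_neg, aeval_C] at this
          have h3 := euclidWeight_add_aeval hgen X
          rw [aeval_X, shearWeight_X, zero_add] at h3
          have h4 := euclidWeight_add_C y x₀ 0 c
          rw [C_0, C_0, add_zero] at h4
          rw [h3, h4]
    have hx : ∀ f, x + aeval y f = x₀ + aeval y (f₀ + f) := fun f => by
      rw [hx₀, map_add]
      ring
    have h0 := hmain f₀
    have hxf₀ : x₀ + aeval y f₀ = x := by
      rw [hx₀]
      ring
    rw [hxf₀] at h0
    rw [hx, hmain, h0, map_add]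
    ring

theorem pairWeight_swap {x y : (ZMod 2)[X][X]} (h : Generates x y) :
    pairWeight y x = pairWeight x y := by
  rcases lt_trichotomy x.natDegree y.natDegree with hlt | heq | hgt
  · rw [pairWeight, if_neg (by omega), if_pos hlt, pairWeight, if_pos hlt]
  · have hgen : Generates x (x + y) := by
      have := (h.symm.shear X).symm
      rwa [aeval_X, add_comm] at this
    have hy : x + aeval (x + y) (X : (ZMod 2)[X]) = y := by
      rw [aeval_X]
      linear_combination add_self_plane x
    have h1 := euclidWeight_add_aeval hgen X
    rw [hy, shearWeight_X, zero_add] at h1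
    rw [pairWeight, if_neg (by omega), if_neg (by omega), pairWeight, if_neg (by omega),
      if_neg (by omega), add_comm y x, h1]
  · rw [pairWeight, if_pos hgt, pairWeight, if_neg (by omega), if_pos hgt]

/-- The invariant of a plane automorphism over `𝔽₂`. -/
noncomputable def planeWeight (g : GA (ZMod 2) 2) : ZMod 2 :=
  pairWeight (planeCoord g 0) (planeCoord g 1)

theorem planeWeight_swap_mul (g : GA (ZMod 2) 2) :
    planeWeight (planeSwap (ZMod 2) * g) = planeWeight g := by
  rw [planeWeight, (planeCoord_swap_mul g).1, (planeCoord_swap_mul g).2]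
  exact pairWeight_swap (generates_planeCoord g)

theorem planeWeight_shear_mul (f : (ZMod 2)[X]) (g : GA (ZMod 2) 2) :
    planeWeight (planeShear f * g) = shearWeight f + planeWeight g := by
  rw [planeWeight, (planeCoord_shear_mul f g).1, (planeCoord_shear_mul f g).2]
  exact pairWeight_shear (generates_planeCoord g) f

theorem planeWeight_one : planeWeight 1 = 0 := by
  rw [planeWeight, planeCoord_one.1, planeCoord_one.2, pairWeight, if_pos (by simp),
    euclidWeight_of_natDegree_eq_zero (natDegree_C _), coeff_X_zero, map_zero]

theorem planeWeight_mul (h g : GA (ZMod 2) 2) :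
    planeWeight (h * g) = planeWeight h + planeWeight g := by
  let H : Subgroup (GA (ZMod 2) 2) :=
    { carrier := {h | ∀ g, planeWeight (h * g) = planeWeight h + planeWeight g}
      mul_mem' := fun {a b} ha hb g => by rw [mul_assoc, ha, hb, ha b, add_assoc]
      one_mem' := fun g => by rw [one_mul, planeWeight_one, zero_add]
      inv_mem' := fun {a} ha g => by
        have h1 := ha (a⁻¹ * g)
        have h2 := ha a⁻¹
        rw [mul_inv_cancel_left] at h1
        rw [mul_inv_cancel, planeWeight_one] at h2
        linear_combination h2 - h1 }
  refine mem_of_swap_of_shear (H := H) (fun g => ?_) (fun f g => ?_) h g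
  · have := planeWeight_swap_mul 1
    rw [mul_one, planeWeight_one] at this
    rw [planeWeight_swap_mul, this, zero_add]
  · have := planeWeight_shear_mul f 1
    rw [mul_one, planeWeight_one, add_zero] at this
    rw [planeWeight_shear_mul, this]

/-- The invariant of plane automorphisms over `𝔽₂` as a homomorphism. -/
noncomputable def planeWeightHom : GA (ZMod 2) 2 →* Multiplicative (ZMod 2) where
  toFun g := Multiplicative.ofAdd (planeWeight g)
  map_one' := by rw [planeWeight_one, ofAdd_zero]
  map_mul' g h := by rw [planeWeight_mul, ofAdd_add]

theorem planeWeight_shear (f : (ZMod 2)[X]) : planeWeight (planeShear f) = shearWeight f := by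
  have := planeWeight_shear_mul f 1
  rwa [mul_one, planeWeight_one, add_zero] at this

theorem planeWeightHom_shear_X : planeWeightHom (planeShear X) = 1 := by
  change Multiplicative.ofAdd (planeWeight (planeShear X)) = 1
  rw [planeWeight_shear, shearWeight_X, ofAdd_zero]

theorem planeWeightHom_linear {A : GA (ZMod 2) 2} (hA : A ∈ linearSubgroup (ZMod 2) 2) :
    planeWeightHom A = 1 := by
  obtain ⟨A, rfl⟩ := hA
  refine hom_eq_one_of_transvection
    (planeWeightHom.comp (Units.map (linearMap (ZMod 2) 2))) (fun i j hij => ?_) A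
  have hS : Units.map (linearMap (ZMod 2) 2) (glTransvection 0 1 (by decide)) = planeShear X := by
    refine ext_coord fun l => ?_
    change ∑ m, MvPolynomial.C (Matrix.transvection 0 1 (1 : ZMod 2) l m) * MvPolynomial.X m = _
    fin_cases l <;>
      simp [planeShear, Matrix.transvection, Matrix.single, Matrix.one_apply, add_comm]
  have hS' : Units.map (linearMap (ZMod 2) 2) (glTransvection 1 0 (by decide)) =
      planeSwap (ZMod 2) * planeShear X * (planeSwap (ZMod 2))⁻¹ := by
    rw [eq_mul_inv_iff_mul_eq, ← hS]
    refine ext_coord fun l => ?_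
    rw [mul_val_coord, mul_val_coord]
    change MvPolynomial.bind₁ (planeSwap (ZMod 2)).val.coord (∑ m, MvPolynomial.C
      (Matrix.transvection 1 0 (1 : ZMod 2) l m) * MvPolynomial.X m) = MvPolynomial.bind₁ (fun l =>
      ∑ m, MvPolynomial.C (Matrix.transvection 0 1 (1 : ZMod 2) l m) * MvPolynomial.X m) _
    fin_cases l <;>
      simp [planeSwap, Matrix.transvection, Matrix.single, Matrix.one_apply, add_comm]
  rw [MonoidHom.comp_apply]
  obtain ⟨rfl, rfl⟩ | ⟨rfl, rfl⟩ : i = 0 ∧ j = 1 ∨ i = 1 ∧ j = 0 := by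
    revert i j
    decide
  · rw [hS, planeWeightHom_shear_X]
  · rw [hS', map_mul, map_mul, planeWeightHom_shear_X, mul_one, map_inv, mul_inv_cancel]

theorem lt_of_eq_two : GLIN (ZMod 2) 2 < GTAM (ZMod 2) 2 ∧ TLIN (ZMod 2) 2 < TA (ZMod 2) 2 := by
  have hα : (Finsupp.single 1 3 : Fin 2 →₀ ℕ) 0 = 0 := by simp
  have hE : elementary 0 (Finsupp.single 1 3) hα = planeShear (X ^ 3 : (ZMod 2)[X]) := by
    refine ext_coord fun l => ?_
    fin_cases l
    · simp [elementary, addMonomial, planeShear, MvPolynomial.X_pow_eq_monomial]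
    · simp [elementary, addMonomial, planeShear]
  refine lt_of_hom planeWeightHom (fun A hA => planeWeightHom_linear hA)
    (elementary_mem_TA 0 _ hα) ?_
  rw [hE]
  change Multiplicative.ofAdd (planeWeight (planeShear (X ^ 3))) ≠ 1
  rw [planeWeight_shear, shearWeight_X_pow_three]
  decide

end Invariant

end PolyAut

theorem mainTheorem3 (n : ℕ) (hn : 1 ≤ n) :
    (∀ (k : Type*) [Field k], IsEmpty (k ≃+* ZMod 2) →
      PolyAut.GLIN k n = PolyAut.GTAM k n ∧ PolyAut.TLIN k n = PolyAut.TA k n) ∧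
    PolyAut.GLIN (ZMod 2) n < PolyAut.GTAM (ZMod 2) n ∧
    PolyAut.TLIN (ZMod 2) n < PolyAut.TA (ZMod 2) n := by
  refine ⟨fun k _ hk => ?_, ?_⟩
  · obtain ⟨c, hc0, hc1⟩ := PolyAut.exists_unit_ne_one hk
    have h := PolyAut.TLIN_eq_TA (n := n) hc0 hc1
    exact ⟨PolyAut.GLIN_eq_GTAM_of_TLIN_eq_TA h, h⟩
  · rcases eq_or_ne n 2 with rfl | h2
    · exact PolyAut.lt_of_eq_two
    · exact PolyAut.lt_of_ne_two hn h2
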